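/- **Conventions.** Let $\mathbb K$ be a field. A persistence module over a totally ordered set $S$ is a functor $V$ from $S$ to $\mathbb K$-vector spaces. For an interval (bar) $I\subseteq S$, that is, a nonempty order-convex subset, the interval module $\mathbb K_I$ is $\mathbb K$ at each $s\in I$ and $0$ elsewhere, with identity maps between indices in $I$. A family of bars $(I_k)_k$ is a barcode of $V$ if $V\cong\bigoplus_k \mathbb K_{I_k}$; a barcode is unique up to reordering. $V$ is barcode-finite if it has a barcode with finitely many bars. Let $S=\mathbb R_{\ge 0}$. Two bars $I,J$ with births (infima) $b\le\beta$ and deaths (suprema, possibly $\infty$) $d,\delta$, respectively, are *interlaced* if $b<\beta\le d<\delta$, and *non-separated* if $d<\beta$ and no element of $S$ lies strictly between $d$ and $\beta$; they form an *interacting pair* if one of the two holds. The quiver codimension $\mathrm{Qcodim}(V)$ of a barcode-finite $V$ is the number of interacting pairs of bars in its barcode. For a finite family $X=(x_i)$ of points of $\mathbb R^2$, the Vietoris–Rips complex at scale $s\ge 0$ has as simplices the nonempty sets of vertices $x_i$ such that the closed balls of radius $s$ about any two of them intersect. $\mathrm{PH}_1(\mathrm{VR}(X,\mathbb R^2))$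 is the persistence module over $\mathbb R_{\ge 0}$ given by degree-1 simplicial homology with coefficients in $\mathbb K$ of these complexes, with the maps induced by inclusion. **The point clouds.** Let $c\ge 0$ be an integer. Call real numbers $\epsilon_0<\epsilon_1<\dots<\epsilon_{c+1}$ *admissible* if $\epsilon_0=1$, $\epsilon_1\in(1,\sqrt2)$, $\epsilon_2\in(\epsilon_1,\sqrt2\,\epsilon_0)$ (if $c\ge 1$), and $\epsilon_n\in(\sqrt2\,\epsilon_{n-3},\sqrt2\,\epsilon_{n-2})$ for $3\le n\le c+1$. For admissible $\epsilon$ let $X_c\subset\mathbb R^2$ consist of the points $$\Bigl(2\sum_{i=0}^{n-1}\epsilon_i,\;0\Bigr),\qquad \Bigl(2\sum_{i=0}^{n-1}\epsilon_i,\;2\epsilon_n\Bigr),\qquad 0\le n\le c+1 .$$ **Theorem.** For every field $\mathbb K$ and every $c\ge 0$ admissible sequences exist, and for every admissible sequence the following hold. The $2(c+2)$ listed points of $X_c$ are distinct, $\mathrm{PH}_1(\mathrm{VR}(X_c,\mathbb R^2))$ is barcode-finite, and $$\mathrm{Qcodim}\bigl(\mathrm{PH}_1(\mathrm{VR}(X_c,\mathbb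 R^2))\bigr)=c .$$ Moreover, its barcode consists of exactly the bars $I_k=[\epsilon_{k+1},\sqrt2\,\epsilon_k)$ for $k=0,\dots,c$; the consecutive pairs $I_k,I_{k+1}$ are interlaced, and no two bars $I_k,I_l$ with $l>k+1$ interact. -/

import Mathlib

open CategoryTheory
open scoped NNReal ENNReal DirectSum

noncomputable section

namespace QuiverCodim

universe u v

/-! ### Persistence modules, interval modules, barcodes -/

/-- A persistence module over the preordered set `S`: vector spaces `V s` and linear maps
`V s → V t` for `s ≤ t`, compatible with identities and composition. -/
abbrev PersistenceModule (K : Type u) [Field K] (S : Type v) [Preorder S] :=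
  S ⥤ ModuleCat.{u} K

/-- A bar: an interval of `S`, that is, a nonempty order-convex subset. -/
structure Bar (S : Type v) [Preorder S] where
  carrier : Set S
  nonempty : carrier.Nonempty
  ordConnected : carrier.OrdConnected

section IntervalModule

variable (K : Type u) [Field K] {S : Type v} [Preorder S]

/-- The space at `s` of the interval module of `I`: all of `K` if `s ∈ I`, and `0` otherwise. -/
def intervalSpace (I : Bar S) (s : S) : Submodule K K where
  carrier := {a | s ∉ I.carrier → a = 0}
  zero_mem' := fun _ => rfl
  add_mem' := fun ha hb h => by rw [ha h, hb h, add_zero]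
  smul_mem' := fun r a ha h => by rw [ha h, smul_zero]

open Classical in
/-- The structure map of the interval module of `I`. For `s, t ∈ I` it is the identity of `K`,
otherwise it is zero (if `s ∉ I` then the source is zero). -/
def intervalMap (I : Bar S) (s t : S) : intervalSpace K I s →ₗ[K] intervalSpace K I t where
  toFun a := ⟨if t ∈ I.carrier then (a : K) else 0, fun h => if_neg h⟩
  map_add' a b := by
    apply Subtype.ext
    by_cases h : t ∈ I.carrier <;> simp [h]
  map_smul' r a := by
    apply Subtype.ext
    by_cases h : t ∈ I.carrier <;> simp [h]

theorem intervalMap_self (I : Bar S) (s : S) : intervalMap K I s s = LinearMap.id := by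
  ext a
  by_cases h : s ∈ I.carrier
  · simp [intervalMap, h]
  · simp [intervalMap, h, a.2 h]

theorem intervalMap_comp (I : Bar S) {s t r : S} (hst : s ≤ t) (htr : t ≤ r) :
    intervalMap K I t r ∘ₗ intervalMap K I s t = intervalMap K I s r := by
  ext a
  by_cases hr : r ∈ I.carrier
  · by_cases ht : t ∈ I.carrier
    · simp [intervalMap, hr, ht]
    · have hs : s ∉ I.carrier := fun hs => ht (I.ordConnected.out hs hr ⟨hst, htr⟩)
      simp [intervalMap, hr, ht, a.2 hs]
  · simp [intervalMap, hr]

/-- The direct sum of the interval modules of a family of bars. -/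
def intervalSum {κ : Type} (B : κ → Bar S) : PersistenceModule K S where
  obj s := ModuleCat.of K (⨁ k, intervalSpace K (B k) s)
  map {s t} _ := ModuleCat.ofHom (DirectSum.lmap fun k => intervalMap K (B k) s t)
  map_id s := by
    ext1
    simp only [intervalMap_self, DirectSum.lmap_id]
    rfl
  map_comp {s t r} f g := by
    ext1
    simp only [ModuleCat.hom_ofHom, ModuleCat.hom_comp, ← DirectSum.lmap_comp,
      intervalMap_comp K _ (leOfHom f) (leOfHom g)]

variable {K}

/-- The family of bars `B` is a barcode of `V`: the module `V` is isomorphic to the direct sum of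
the interval modules of the `B k`. -/
def IsBarcode (V : PersistenceModule K S) {κ : Type} (B : κ → Bar S) : Prop :=
  Nonempty (V ≅ intervalSum K B)

/-- `V` is barcode-finite: it has a barcode with finitely many bars. -/
def BarcodeFinite (V : PersistenceModule K S) : Prop :=
  ∃ (n : ℕ) (B : Fin n → Bar S), IsBarcode V B

end IntervalModule

/-! ### Interacting pairs and the quiver codimension, for modules over `ℝ≥0` -/

/-- The birth time of a bar, its infimum. -/
def Bar.birth (I : Bar ℝ≥0) : ℝ≥0∞ := ⨅ s ∈ I.carrier, (s : ℝ≥0∞)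

/-- The death time of a bar, its supremum, possibly `∞`. -/
def Bar.death (I : Bar ℝ≥0) : ℝ≥0∞ := ⨆ s ∈ I.carrier, (s : ℝ≥0∞)

/-- `I` and `J` are interlaced, `I` being the bar that is born first. -/
def Interlaced (I J : Bar ℝ≥0) : Prop :=
  I.birth < J.birth ∧ J.birth ≤ I.death ∧ I.death < J.death

/-- `I` and `J` are non-separated, `I` being the bar that is born first: `I` dies before `J` is
born, with no index strictly in between. -/
def NonSeparated (I J : Bar ℝ≥0) : Prop :=
  I.death < J.birth ∧ ¬ ∃ s : ℝ≥0, I.death < (s : ℝ≥0∞) ∧ (s : ℝ≥0∞) < J.birth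

/-- `I` and `J`, in one of the two orders, are interlaced or non-separated. -/
def Interacting (I J : Bar ℝ≥0) : Prop :=
  (Interlaced I J ∨ NonSeparated I J) ∨ (Interlaced J I ∨ NonSeparated J I)

/-- The number of interacting (unordered) pairs in a finite list of bars. -/
def numInteracting {n : ℕ} (B : Fin n → Bar ℝ≥0) : ℕ :=
  {p : Fin n × Fin n | p.1 < p.2 ∧ Interacting (B p.1) (B p.2)}.ncard

open Classical in
/-- The quiver codimension of a barcode-finite module: the number of interacting pairs of bars in
its barcode. (The barcode is unique up to reordering, so the choice made here does not matter;
the value `0` for modules that are not barcode-finite is a convention.) -/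
def qcodim {K : Type u} [Field K] (V : PersistenceModule K ℝ≥0) : ℕ :=
  if h : BarcodeFinite V then numInteracting h.choose_spec.choose else 0

/-! ### Simplicial homology with field coefficients -/

section Subquotient

variable {R M : Type*} [Ring R] [AddCommGroup M] [Module R M]

/-- The quotient of the submodule `Z` by (its intersection with) the submodule `B`. -/
abbrev Subquotient (Z B : Submodule R M) := Z ⧸ B.comap Z.subtype

/-- The map of subquotients induced by the identity of the ambient module. -/
def subquotientMap {Z Z' B B' : Submodule R M} (hZ : Z ≤ Z') (hB : B ≤ B') :
    Subquotient Z B →ₗ[R] Subquotient Z' B' :=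
  Submodule.mapQ _ _ (Submodule.inclusion hZ) fun _ hz => hB hz

theorem subquotientMap_self {Z B : Submodule R M} (hZ : Z ≤ Z) (hB : B ≤ B) :
    subquotientMap hZ hB = LinearMap.id :=
  Submodule.linearMap_qext _ rfl

theorem subquotientMap_comp {Z Z' Z'' B B' B'' : Submodule R M} (hZ : Z ≤ Z') (hB : B ≤ B')
    (hZ' : Z' ≤ Z'') (hB' : B' ≤ B'') :
    subquotientMap hZ' hB' ∘ₗ subquotientMap hZ hB =
      subquotientMap (hZ.trans hZ') (hB.trans hB') :=
  Submodule.linearMap_qext _ rfl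

end Subquotient

section Homology

variable (K : Type u) [Field K] {ι : Type} [LinearOrder ι]

/-- The space of `d`-chains of the full simplex on the ordered vertex set `ι`: its basis consists
of the lists `v₀ < ⋯ < v_d` of vertices. -/
abbrev Chain (ι : Type) [LinearOrder ι] (d : ℕ) : Type u := (Fin (d + 1) ↪o ι) →₀ K

/-- The boundary operator `[v₀, …, v_{d+1}] ↦ ∑ i, (-1)ⁱ [v₀, …, omit vᵢ, …, v_{d+1}]`. -/
def boundary (d : ℕ) : Chain K ι (d + 1) →ₗ[K] Chain K ι d :=
  Finsupp.lsum K fun σ : Fin (d + 1 + 1) ↪o ι =>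
    ∑ i : Fin (d + 2), (-1 : K) ^ (i : ℕ) • Finsupp.lsingle ((Fin.succAboveOrderEmb i).trans σ)

/-- The `d`-chains of the simplicial complex `X`: those supported on lists of vertices that span
a simplex of `X`. -/
def chains (X : AbstractSimplicialComplex ι) (d : ℕ) : Submodule K (Chain K ι d) :=
  Finsupp.supported K K {σ | Finset.univ.map σ.toEmbedding ∈ X}

/-- The `d`-cycles of `X`: the `d`-chains of `X` with zero boundary (all chains, if `d = 0`). -/
def cycles (X : AbstractSimplicialComplex ι) : (d : ℕ) → Submodule K (Chain K ι d)
  | 0 => chains K X 0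
  | d + 1 => chains K X (d + 1) ⊓ LinearMap.ker (boundary K d)

/-- The `d`-boundaries of `X`: the boundaries of the `(d+1)`-chains of `X`. -/
def boundaries (X : AbstractSimplicialComplex ι) (d : ℕ) : Submodule K (Chain K ι d) :=
  (chains K X (d + 1)).map (boundary K d)

/-- The simplicial homology of `X` in degree `d` with coefficients in `K`, cycles modulo
boundaries. -/
abbrev Homology (X : AbstractSimplicialComplex ι) (d : ℕ) : Type u :=
  Subquotient (cycles K X d) (boundaries K X d)

variable {K}

theorem chains_mono {X Y : AbstractSimplicialComplex ι} (h : X ≤ Y) (d : ℕ) :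
    chains K X d ≤ chains K Y d :=
  Finsupp.supported_mono fun _ hσ => h hσ

theorem cycles_mono {X Y : AbstractSimplicialComplex ι} (h : X ≤ Y) :
    (d : ℕ) → cycles K X d ≤ cycles K Y d
  | 0 => chains_mono h 0
  | d + 1 => inf_le_inf_right _ (chains_mono h (d + 1))

theorem boundaries_mono {X Y : AbstractSimplicialComplex ι} (h : X ≤ Y) (d : ℕ) :
    boundaries K X d ≤ boundaries K Y d :=
  Submodule.map_mono (chains_mono h (d + 1))

variable (K)

/-- The map in homology induced by an inclusion of simplicial complexes. -/
def homologyMap {X Y : AbstractSimplicialComplex ι} (h : X ≤ Y) (d : ℕ) :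
    Homology K X d →ₗ[K] Homology K Y d :=
  subquotientMap (cycles_mono h d) (boundaries_mono h d)

/-- The degree `d` persistent homology of a filtration of simplicial complexes. -/
def persistentHomology {S : Type v} [Preorder S] (d : ℕ) (F : S →o AbstractSimplicialComplex ι) :
    PersistenceModule K S where
  obj s := ModuleCat.of K (Homology K (F s) d)
  map {s t} f := ModuleCat.ofHom (homologyMap K (F.monotone (leOfHom f)) d)
  map_id s := by
    ext1
    exact subquotientMap_self (cycles_mono le_rfl d) (boundaries_mono le_rfl d)
  map_comp f g := by
    ext1
    exact (subquotientMap_comp (cycles_mono (F.monotone (leOfHom f)) d)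
      (boundaries_mono (F.monotone (leOfHom f)) d) (cycles_mono (F.monotone (leOfHom g)) d)
      (boundaries_mono (F.monotone (leOfHom g)) d)).symm

end Homology

/-! ### The Vietoris-Rips filtration -/

/-- The Vietoris-Rips filtration of a family of points `x i` of a metric space `M`. At scale `s`,
a nonempty finite set of points spans a simplex when the closed balls of radius `s` about any two
of them meet in `M`. -/
def vietorisRips {M : Type v} [PseudoMetricSpace M] {ι : Type} (x : ι → M) :
    ℝ≥0 →o AbstractSimplicialComplex ι where
  toFun s :=
    { faces := {σ | σ.Nonempty ∧ (σ : Set ι).Pairwise fun i j =>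
        (Metric.closedBall (x i) s ∩ Metric.closedBall (x j) s).Nonempty}
      isRelLowerSet_faces := fun _ hσ =>
        ⟨hσ.1, fun _ hτσ hτ => ⟨hτ, hσ.2.mono (Finset.coe_subset.mpr hτσ)⟩⟩
      singleton_mem := fun i => ⟨Finset.singleton_nonempty i, by simp⟩ }
  monotone' := fun _ _ hst _ hσ =>
    ⟨hσ.1, hσ.2.mono' fun _ _ h => h.mono (Set.inter_subset_inter
      (Metric.closedBall_subset_closedBall hst) (Metric.closedBall_subset_closedBall hst))⟩

/-! ### The point clouds -/

/-- The conditions on the parameters `ε 0 < ε 1 < ⋯ < ε (c + 1)` of the point cloud `X_c`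
(values of `ε` beyond `c + 1` play no role). -/
structure Admissible (c : ℕ) (ε : ℕ → ℝ) : Prop where
  increasing : ∀ n ≤ c, ε n < ε (n + 1)
  zero : ε 0 = 1
  one : ε 1 ∈ Set.Ioo 1 √2
  two : 1 ≤ c → ε 2 ∈ Set.Ioo (ε 1) (√2 * ε 0)
  step : ∀ n, 3 ≤ n → n ≤ c + 1 → ε n ∈ Set.Ioo (√2 * ε (n - 3)) (√2 * ε (n - 2))

/-- The point cloud `X_c` in the plane, with its `2 (c + 2)` points. For `0 ≤ n ≤ c + 1` and
`a = 2 (ε 0 + ⋯ + ε (n - 1))` it contains the points `(a, 0)`, at index `(n, 0)`, and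
`(a, 2 ε n)`, at index `(n, 1)`. -/
def pointCloud (c : ℕ) (ε : ℕ → ℝ) (p : Fin (c + 2) ×ₗ Fin 2) : EuclideanSpace ℝ (Fin 2) :=
  !₂[2 * ∑ i ∈ Finset.range (ofLex p).1, ε i, if (ofLex p).2 = 0 then 0 else 2 * ε (ofLex p).1]

end QuiverCodim

end

/-!
Let `A n` and `B n` be the lower and the upper point of the column `n` (`bot n` and `top n` below).
Half the distance of `A n` and `B n`, and of `A n` and `A (n + 1)`, is `ε n`; the edge from `B n` to
`B (n + 1)` appears before the scale `ε (n + 1)`; the diagonal from `B n` to `A (n + 1)` appears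
at the scale `√2 * ε n`. So the square between the columns `k` and `k + 1` carries a cycle
(`squareChain`) that is born at `ε (k + 1)` and filled by two triangles at `√2 * ε k`. By
`isBarcode_of_basis` it is enough to show that, at each scale, the squares that are present and not
filled represent a basis of the first homology; the isomorphism with the sum of interval modules is
then natural because the same chains are used at all scales.

*Independence.* The upper edge of an unfilled square lies in no triangle
(`Admissible.not_near_of_near_top`), so its coefficient vanishes on boundaries, while on the squares
it is the Kronecker delta.

*Spanning.* After subtracting a combination of squares, a cycle avoids the upper edges of the
unfilled squares. The vertices of the remaining graph can be eliminated one at a time, each being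
dominated by a later vertex among the vertices that are left: in the columns whose square is filled,
`A (n + 1)` dominates both points of the column `n`, and otherwise only leaves and isolated points
are met (`Admissible.exists_dominating`). Running through this elimination backwards, any linear
form that vanishes on the boundaries, that is, any cocycle, gets a potential along the edges of the graph
(`exists_potential`), hence vanishes on the cycle, which is therefore a boundary
(`mem_boundaries_of_elimination`).

Finally, `qcodim` is defined with a chosen barcode, so the uniqueness of finite barcodes is needed.
It holds because a nonzero composite `K_I → K_J → K_I` forces `I = J`: for inverse isomorphisms of
sums of interval modules, the blocks belonging to one bar `I` are mutually inverse matrices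
(`card_fiber_le`, `exists_equiv_of_iso`).
-/

noncomputable section

namespace QuiverCodim

universe u v

/-! ### Uniqueness of barcodes -/

section Uniqueness

variable {K : Type u} [Field K] {S : Type v} [LinearOrder S]

theorem Bar.ext_carrier {I J : Bar S} (h : I.carrier = J.carrier) : I = J := by
  cases I; cases J; simpa using h

open Classical in
/-- The generator of the interval module of `I` at `s`: it is `1` if `s ∈ I`, and `0` otherwise. -/
def intervalGen (K : Type u) [Field K] (I : Bar S) (s : S) : intervalSpace K I s :=
  ⟨if s ∈ I.carrier then 1 else 0, fun h => if_neg h⟩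

theorem intervalMap_intervalGen (I : Bar S) {s : S} (t : S) (hs : s ∈ I.carrier) :
    intervalMap K I s t (intervalGen K I s) = intervalGen K I t := by
  apply Subtype.ext
  simp [intervalMap, intervalGen, hs]

theorem smul_intervalGen (I : Bar S) (s : S) (a : intervalSpace K I s) :
    (a : K) • intervalGen K I s = a := by
  apply Subtype.ext
  by_cases h : s ∈ I.carrier
  · simp [intervalGen, h]
  · simp [intervalGen, h, a.2 h]

/-- A morphism between direct sums of interval modules, at the index `s`, as a linear map. -/
def stage {κ κ' : Type} {B : κ → Bar S} {B' : κ' → Bar S}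
    (φ : intervalSum K B ⟶ intervalSum K B') (s : S) :
    (⨁ k, intervalSpace K (B k) s) →ₗ[K] ⨁ k, intervalSpace K (B' k) s :=
  (φ.app s).hom

theorem stage_lmap {κ κ' : Type} {B : κ → Bar S} {B' : κ' → Bar S}
    (φ : intervalSum K B ⟶ intervalSum K B') {s t : S} (hst : s ≤ t)
    (x : ⨁ k, intervalSpace K (B k) s) :
    stage φ t (DirectSum.lmap (fun k => intervalMap K (B k) s t) x) =
      DirectSum.lmap (fun k => intervalMap K (B' k) s t) (stage φ s x) :=
  congrArg (fun f => f.hom x) (φ.naturality (homOfLE hst))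

theorem stage_inv_stage_hom {κ κ' : Type} {B : κ → Bar S} {B' : κ' → Bar S}
    (φ : intervalSum K B ≅ intervalSum K B') (s : S) (x : ⨁ k, intervalSpace K (B k) s) :
    stage φ.inv s (stage φ.hom s x) = x :=
  congrArg (fun f => (f.app s).hom x) φ.hom_inv_id

/-- The matrix, at the index `s`, of a morphism between direct sums of interval modules, with
respect to the generators `intervalGen`. -/
def entry {κ κ' : Type} [DecidableEq κ] {B : κ → Bar S} {B' : κ' → Bar S}
    (φ : intervalSum K B ⟶ intervalSum K B') (s : S) (b : κ') (a : κ) : K :=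
  stage φ s (DirectSum.lof K κ (fun k => intervalSpace K (B k) s) a (intervalGen K (B a) s)) b

section

variable {κ κ' : Type} [DecidableEq κ] {B : κ → Bar S} {B' : κ' → Bar S}
  (φ : intervalSum K B ⟶ intervalSum K B')

theorem mem_of_entry_ne_zero {s : S} {b : κ'} {a : κ} (h : entry φ s b a ≠ 0) :
    s ∈ (B' b).carrier := by
  by_contra hs
  exact h (Subtype.property (stage φ s _ b) hs)

theorem mem_of_entry_ne_zero' {s : S} {b : κ'} {a : κ} (h : entry φ s b a ≠ 0) :
    s ∈ (B a).carrier := by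
  by_contra hs
  apply h
  have : intervalGen K (B a) s = 0 := Subtype.ext (if_neg hs)
  rw [entry, this, map_zero, map_zero]
  rfl

theorem entry_eq {s t : S} (hst : s ≤ t) {b : κ'} {a : κ} (hs : s ∈ (B a).carrier)
    (ht : t ∈ (B' b).carrier) : entry φ t b a = entry φ s b a := by
  have h := stage_lmap φ hst (DirectSum.lof K κ (fun k => intervalSpace K (B k) s) a
    (intervalGen K (B a) s))
  rw [DirectSum.lmap_lof, intervalMap_intervalGen _ _ hs] at h
  rw [entry, h, DirectSum.lmap_apply]
  simp [intervalMap, ht, entry]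

/-- A nonzero composite `K_I → K_J → K_I` forces `I = J`. -/
theorem eq_of_entry_mul_entry_ne_zero [DecidableEq κ'] (φ : intervalSum K B ⟶ intervalSum K B')
    (ψ : intervalSum K B' ⟶ intervalSum K B) {s : S} {a a' : κ} {b : κ'} (haa : B a' = B a)
    (h : entry ψ s a' b * entry φ s b a ≠ 0) : B' b = B a := by
  have hψ := left_ne_zero_of_mul h
  have hφ := right_ne_zero_of_mul h
  have hsa := mem_of_entry_ne_zero' φ hφ
  have hsb := mem_of_entry_ne_zero φ hφ
  apply Bar.ext_carrier
  ext t
  rcases le_total s t with hst | hts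
  · constructor
    · intro ht
      rw [← entry_eq φ hst hsa ht] at hφ
      exact mem_of_entry_ne_zero' φ hφ
    · intro ht
      rw [← haa] at ht
      rw [← entry_eq ψ hst hsb ht] at hψ
      exact mem_of_entry_ne_zero' ψ hψ
  · constructor
    · intro ht
      rw [entry_eq ψ hts ht (haa ▸ hsa)] at hψ
      exact haa ▸ mem_of_entry_ne_zero ψ hψ
    · intro ht
      rw [entry_eq φ hts ht hsb] at hφ
      exact mem_of_entry_ne_zero φ hφ

end

variable {κ κ' : Type} [Fintype κ'] [DecidableEq κ] [DecidableEq κ'] {B : κ → Bar S}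
  {B' : κ' → Bar S}

theorem sum_entry_mul_entry (φ : intervalSum K B ≅ intervalSum K B') {s : S} (a' : κ) {a : κ}
    (hs : s ∈ (B a).carrier) :
    ∑ b, entry φ.inv s a' b * entry φ.hom s b a = if a = a' then 1 else 0 := by
  set x := stage φ.hom s (DirectSum.lof K κ
    (fun k => intervalSpace K (B k) s) a (intervalGen K (B a) s)) with hx
  have hsum : x = ∑ b, entry φ.hom s b a •
      DirectSum.lof K κ' (fun k => intervalSpace K (B' k) s) b (intervalGen K (B' b) s) := by
    conv_lhs => rw [← DirectSum.sum_univ_of x]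
    refine Finset.sum_congr rfl fun b _ => ?_
    rw [← map_smul, entry, ← hx, smul_intervalGen]
    rfl
  have hinv : stage φ.inv s x = _ := stage_inv_stage_hom φ s _
  rw [hsum, map_sum] at hinv
  simp only [map_smul] at hinv
  have h3 := congrArg (fun y : ⨁ k, intervalSpace K (B k) s => (y a' : K)) hinv
  simp only [DirectSum.sum_apply, DirectSum.smul_apply, Submodule.coe_sum, Submodule.coe_smul,
    smul_eq_mul] at h3
  rw [Finset.sum_congr rfl fun b _ => mul_comm _ _]
  refine h3.trans ?_
  split_ifs with h
  · subst h
    rw [DirectSum.lof_apply]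
    simp [intervalGen, hs]
  · rw [DirectSum.lof_eq_of, DirectSum.of_eq_of_ne _ _ _ (Ne.symm h)]
    rfl

theorem card_fiber_le [Fintype κ] (φ : intervalSum K B ≅ intervalSum K B') (I : Bar S) :
    Nat.card {a // B a = I} ≤ Nat.card {b // B' b = I} := by
  classical
  obtain ⟨s, hs⟩ := I.nonempty
  let M : Matrix {b // B' b = I} {a // B a = I} K := fun b a => entry φ.hom s b a
  let N : Matrix {a // B a = I} {b // B' b = I} K := fun a b => entry φ.inv s a b
  have hNM : N * M = 1 := by
    ext a' a
    have h := sum_entry_mul_entry φ a'.1 (a := a.1) (s := s) (by rw [a.2]; exact hs)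
    rw [Matrix.mul_apply, Matrix.one_apply]
    have h2 : ∑ b, entry φ.inv s a'.1 b * entry φ.hom s b a.1 =
        ∑ b : {b // B' b = I}, entry φ.inv s a'.1 b.1 * entry φ.hom s b.1 a.1 := by
      rw [← Finset.sum_subtype (Finset.univ.filter fun b => B' b = I) (by simp)
        (fun b => entry φ.inv s a'.1 b * entry φ.hom s b a.1)]
      exact (Finset.sum_filter_of_ne fun b _ hb => (eq_of_entry_mul_entry_ne_zero φ.hom φ.inv
        (a'.2.trans a.2.symm) hb).trans a.2).symm
    rw [← h2, h]
    simp only [Subtype.ext_iff, eq_comm]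
  have h1 := Matrix.rank_mul_le_left N M
  rw [hNM, Matrix.rank_one] at h1
  rw [Nat.card_eq_fintype_card, Nat.card_eq_fintype_card]
  exact h1.trans N.rank_le_card_width

/-- Two finite barcodes of isomorphic persistence modules agree up to reordering. -/
theorem exists_equiv_of_iso [Fintype κ] (φ : intervalSum K B ≅ intervalSum K B') :
    ∃ e : κ ≃ κ', ∀ a, B' (e a) = B a := by
  have h : ∀ I, Nonempty ({a // B a = I} ≃ {b // B' b = I}) := fun I =>
    Finite.card_eq.mp (le_antisymm (card_fiber_le φ I) (card_fiber_le φ.symm I))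
  exact ⟨Equiv.ofFiberEquiv fun I => (h I).some, fun a => Equiv.ofFiberEquiv_map _ a⟩

end Uniqueness

theorem Interacting.symm {I J : Bar ℝ≥0} (h : Interacting I J) : Interacting J I := Or.symm h

theorem numInteracting_le_of_equiv {n m : ℕ} {B : Fin n → Bar ℝ≥0} {B' : Fin m → Bar ℝ≥0}
    (e : Fin n ≃ Fin m) (he : ∀ a, B' (e a) = B a) : numInteracting B ≤ numInteracting B' := by
  refine Set.ncard_le_ncard_of_injOn
    (fun p => if e p.1 < e p.2 then (e p.1, e p.2) else (e p.2, e p.1)) ?_ ?_ (Set.toFinite _)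
  · rintro ⟨a, b⟩ ⟨hab, hI⟩
    have hne : e a ≠ e b := fun h => hab.ne (e.injective h)
    simp only
    split_ifs with h
    · exact ⟨h, by simpa only [he] using hI⟩
    · exact ⟨lt_of_le_of_ne (not_lt.mp h) hne.symm, by simpa only [he] using hI.symm⟩
  · rintro ⟨a, b⟩ ⟨hab, -⟩ ⟨a', b'⟩ ⟨hab', -⟩ h
    simp only at h hab hab'
    split_ifs at h <;> simp only [Prod.mk.injEq, e.injective.eq_iff] at h ⊢ <;>
      obtain ⟨rfl, rfl⟩ := h
    · exact ⟨rfl, rfl⟩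
    · exact absurd hab hab'.asymm
    · exact absurd hab hab'.asymm
    · exact ⟨rfl, rfl⟩

/-- The quiver codimension may be computed from any finite barcode. -/
theorem qcodim_eq_numInteracting {K : Type u} [Field K] {V : PersistenceModule K ℝ≥0} {n : ℕ}
    {B : Fin n → Bar ℝ≥0} (hB : IsBarcode V B) : qcodim V = numInteracting B := by
  have h : BarcodeFinite V := ⟨n, B, hB⟩
  rw [qcodim, dif_pos h]
  obtain ⟨φ⟩ := hB
  obtain ⟨ψ⟩ := h.choose_spec.choose_spec
  obtain ⟨e, he⟩ := exists_equiv_of_iso (ψ.symm ≪≫ φ)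
  refine le_antisymm (numInteracting_le_of_equiv e he) (numInteracting_le_of_equiv e.symm ?_)
  intro a
  rw [← he, e.apply_symm_apply]

/-! ### Barcodes from representing cycles -/

section Barcode

variable {K : Type u} [Field K] {ι : Type} [LinearOrder ι]

/-- The combination `∑ k, x k • z k` of the chains `z k`, for a point `x` of a direct sum of
interval modules. -/
def barChain {S : Type v} [LinearOrder S] {d n : ℕ} (I : Fin n → Bar S) (z : Fin n → Chain K ι d)
    (s : S) : (⨁ k, intervalSpace K (I k) s) →ₗ[K] Chain K ι d :=
  DirectSum.toModule K (Fin n) _ fun k =>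
    (LinearMap.toSpanSingleton K _ (z k)).comp (intervalSpace K (I k) s).subtype

theorem barChain_apply {S : Type v} [LinearOrder S] {d n : ℕ} (I : Fin n → Bar S)
    (z : Fin n → Chain K ι d) (s : S) (x : ⨁ k, intervalSpace K (I k) s) :
    barChain I z s x = ∑ k, (x k : K) • z k := by
  conv_lhs => rw [← DirectSum.sum_univ_of x]
  rw [map_sum]
  refine Finset.sum_congr rfl fun k _ => ?_
  rw [barChain, ← DirectSum.lof_eq_of K, DirectSum.toModule_lof]
  rfl

/-- Chains `z k` that are cycles during the bar `I k`, boundaries after it, and represent a basis of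
the homology at every index exhibit the family `I` as a barcode of persistent homology. -/
theorem isBarcode_of_basis {S : Type v} [LinearOrder S] {d n : ℕ}
    (F : S →o AbstractSimplicialComplex ι) (I : Fin n → Bar S) (z : Fin n → Chain K ι d)
    (hz : ∀ k s, s ∈ (I k).carrier → z k ∈ cycles K (F s) d)
    (hz' : ∀ k s t, s ≤ t → s ∈ (I k).carrier → t ∉ (I k).carrier → z k ∈ boundaries K (F t) d)
    (hspan : ∀ s, ∀ y ∈ cycles K (F s) d, ∃ a : Fin n → K,
      (∀ k, s ∉ (I k).carrier → a k = 0) ∧ y - ∑ k, a k • z k ∈ boundaries K (F s) d)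
    (hind : ∀ s, ∀ a : Fin n → K, (∀ k, s ∉ (I k).carrier → a k = 0) →
      ∑ k, a k • z k ∈ boundaries K (F s) d → ∀ k, a k = 0) :
    IsBarcode (persistentHomology K d F) I := by
  have hmem : ∀ s x, barChain I z s x ∈ cycles K (F s) d := by
    intro s x
    rw [barChain_apply]
    refine Submodule.sum_mem _ fun k _ => ?_
    by_cases hs : s ∈ (I k).carrier
    · exact Submodule.smul_mem _ _ (hz k s hs)
    · rw [(x k).2 hs, zero_smul]
      exact Submodule.zero_mem _
  let Φ : ∀ s, (⨁ k, intervalSpace K (I k) s) →ₗ[K] Homology K (F s) d := fun s =>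
    (Submodule.mkQ _).comp ((barChain I z s).codRestrict _ (hmem s))
  have hΦ : ∀ s x, Φ s x = 0 ↔ barChain I z s x ∈ boundaries K (F s) d := by
    intro s x
    exact Submodule.Quotient.mk_eq_zero _
  have hbij : ∀ s, Function.Bijective (Φ s) := by
    intro s
    constructor
    · rw [← LinearMap.ker_eq_bot, LinearMap.ker_eq_bot']
      intro x hx
      rw [hΦ, barChain_apply] at hx
      ext k
      exact hind s (fun k => (x k : K)) (fun k hk => (x k).2 hk) hx k
    · intro q
      obtain ⟨⟨y, hy⟩, rfl⟩ := Submodule.Quotient.mk_surjective _ q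
      obtain ⟨a, ha, hya⟩ := hspan s y hy
      refine ⟨∑ k, DirectSum.lof K _ (fun k => intervalSpace K (I k) s) k ⟨a k, ha k⟩, ?_⟩
      rw [eq_comm]
      refine (Submodule.Quotient.eq _).mpr ?_
      rw [Submodule.mem_comap]
      convert hya using 1
      rw [map_sub]
      congr 1
      change barChain I z s _ = _
      rw [map_sum]
      refine Finset.sum_congr rfl fun k _ => ?_
      rw [barChain, DirectSum.toModule_lof]
      rfl
  refine ⟨(NatIso.ofComponents
    (fun s => (LinearEquiv.ofBijective (Φ s) (hbij s)).toModuleIso) ?_).symm⟩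
  intro s t f
  have hst := leOfHom f
  ext1
  refine DirectSum.linearMap_ext K fun k => LinearMap.ext fun a => ?_
  change Φ t (DirectSum.lmap (fun k => intervalMap K (I k) s t) (DirectSum.lof K _ _ k a)) =
    homologyMap K (F.monotone hst) d (Φ s (DirectSum.lof K _ _ k a))
  rw [DirectSum.lmap_lof]
  refine (Submodule.Quotient.eq _).mpr ?_
  rw [Submodule.mem_comap]
  change barChain I z t _ - barChain I z s _ ∈ _
  rw [barChain, DirectSum.toModule_lof, barChain, DirectSum.toModule_lof]
  change (intervalMap K (I k) s t a : K) • z k - (a : K) • z k ∈ _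
  by_cases ht : t ∈ (I k).carrier
  · simp [intervalMap, ht]
  · by_cases hs : s ∈ (I k).carrier
    · rw [← sub_smul]
      exact Submodule.smul_mem _ _ (hz' k s t hst hs ht)
    · simp [intervalMap, ht, a.2 hs]

end Barcode

/-! ### Oriented edges and triangles -/

section Edges

variable {K : Type u} [Field K] {ι : Type} [LinearOrder ι]

/-- The list `u < v` of two vertices. -/
def pairEmb {u v : ι} (h : u < v) : Fin 2 ↪o ι :=
  OrderEmbedding.ofStrictMono ![u, v] (by
    rw [Fin.strictMono_iff_lt_succ]; intro i; fin_cases i; simpa using h)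

/-- The list `u < v < w` of three vertices. -/
def tripleEmb {u v w : ι} (h : u < v) (h' : v < w) : Fin 3 ↪o ι :=
  OrderEmbedding.ofStrictMono ![u, v, w] (by
    rw [Fin.strictMono_iff_lt_succ]; intro i; fin_cases i
    · simpa using h
    · simpa using h')

theorem emb_eq_pairEmb (σ : Fin 2 ↪o ι) :
    σ = pairEmb (σ.strictMono (show (0 : Fin 2) < 1 by decide)) := by
  ext i; fin_cases i <;> rfl

theorem map_univ_emb_two (σ : Fin 2 ↪o ι) :
    Finset.univ.map σ.toEmbedding = {σ 0, σ 1} := by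
  ext x; simp [Fin.exists_fin_two, eq_comm]

variable (K) in
/-- The oriented edge from `u` to `v`, as a chain: it is `[u, v]` or `-[v, u]`, according to the
order of the vertices, and `0` if `u = v`. -/
def orientedEdge (u v : ι) : Chain K ι 1 :=
  if h : u < v then Finsupp.single (pairEmb h) 1
  else if h : v < u then -Finsupp.single (pairEmb h) 1 else 0

theorem orientedEdge_of_lt {u v : ι} (h : u < v) :
    orientedEdge K u v = Finsupp.single (pairEmb h) 1 := dif_pos h

theorem orientedEdge_self (u : ι) : orientedEdge K u u = 0 := by simp [orientedEdge]

theorem orientedEdge_symm (u v : ι) : orientedEdge K v u = -orientedEdge K u v := by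
  rcases lt_trichotomy u v with h | rfl | h
  · simp [orientedEdge, h, h.not_gt]
  · simp [orientedEdge_self]
  · simp [orientedEdge, h, h.not_gt]

variable (K) in
/-- The vertex `u`, as a chain. -/
def vertexChain (u : ι) : Chain K ι 0 :=
  Finsupp.single (OrderEmbedding.ofStrictMono (fun _ : Fin 1 => u)
    (Subsingleton.strictMono (α := Fin 1) _)) 1

theorem boundary_orientedEdge (u v : ι) :
    boundary K 0 (orientedEdge K u v) = vertexChain K v - vertexChain K u := by
  have key : ∀ {u v : ι}, u < v →
      boundary K 0 (orientedEdge K u v) = vertexChain K v - vertexChain K u := by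
    intro u v h
    rw [orientedEdge_of_lt h, boundary, Finsupp.lsum_single, LinearMap.sum_apply,
      Fin.sum_univ_two]
    simp only [LinearMap.smul_apply, Finsupp.lsingle_apply, Fin.val_zero, Fin.val_one, pow_zero,
      pow_one, one_smul, neg_smul, sub_eq_add_neg, vertexChain]
    congr 3
    · ext i; fin_cases i; rfl
    · ext i; fin_cases i; rfl
  rcases lt_trichotomy u v with h | rfl | h
  · exact key h
  · simp [orientedEdge_self]
  · rw [orientedEdge_symm, map_neg, key h, neg_sub]

theorem boundary_single_triple {u v w : ι} (h : u < v) (h' : v < w) :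
    boundary K 1 (Finsupp.single (tripleEmb h h') 1) =
      orientedEdge K u v + orientedEdge K v w + orientedEdge K w u := by
  rw [orientedEdge_symm u w, orientedEdge_of_lt h, orientedEdge_of_lt h',
    orientedEdge_of_lt (h.trans h'), boundary, Finsupp.lsum_single, LinearMap.sum_apply,
    Fin.sum_univ_three]
  have h0 : (Fin.succAboveOrderEmb (0 : Fin 3)).trans (tripleEmb h h') = pairEmb h' := by
    ext i; fin_cases i <;> rfl
  have h1 : (Fin.succAboveOrderEmb (1 : Fin 3)).trans (tripleEmb h h') =
      pairEmb (h.trans h') := by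
    ext i; fin_cases i <;> rfl
  have h2 : (Fin.succAboveOrderEmb (2 : Fin 3)).trans (tripleEmb h h') = pairEmb h := by
    ext i; fin_cases i <;> rfl
  simp only [LinearMap.smul_apply, Finsupp.lsingle_apply]
  erw [h0, h1, h2]
  simp
  abel

variable {X : AbstractSimplicialComplex ι}

theorem orientedEdge_mem_chains {u v : ι} (h : ({u, v} : Finset ι) ∈ X) :
    orientedEdge K u v ∈ chains K X 1 := by
  have key : ∀ {u v : ι} (_ : ({u, v} : Finset ι) ∈ X) (_ : u < v),
      orientedEdge K u v ∈ chains K X 1 := by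
    intro u v h huv
    rw [orientedEdge_of_lt huv]
    refine Finsupp.single_mem_supported K _ ?_
    change Finset.univ.map (pairEmb huv).toEmbedding ∈ X
    rw [map_univ_emb_two]
    exact h
  rcases lt_trichotomy u v with huv | rfl | huv
  · exact key h huv
  · rw [orientedEdge_self]; exact Submodule.zero_mem _
  · rw [orientedEdge_symm]
    exact Submodule.neg_mem _ (key (by rwa [Finset.pair_comm]) huv)

theorem triangle_mem_boundaries {u v w : ι} (h : ({u, v, w} : Finset ι) ∈ X) :
    orientedEdge K u v + orientedEdge K v w + orientedEdge K w u ∈ boundaries K X 1 := by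
  have key : ∀ {u v w : ι} (_ : ({u, v, w} : Finset ι) ∈ X) (_ : u < v) (_ : v < w),
      orientedEdge K u v + orientedEdge K v w + orientedEdge K w u ∈ boundaries K X 1 := by
    intro u v w h huv hvw
    rw [← boundary_single_triple huv hvw]
    refine Submodule.mem_map_of_mem (Finsupp.single_mem_supported K _ ?_)
    have : Finset.univ.map (tripleEmb huv hvw).toEmbedding = {u, v, w} := by
      ext x; simp [Fin.exists_fin_succ, tripleEmb, eq_comm]
    simpa [this] using h
  -- A cyclic rotation does not change the sum, a transposition changes its sign.
  have swap : ∀ {u v w : ι}, orientedEdge K u v + orientedEdge K v w + orientedEdge K w u =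
      -(orientedEdge K v u + orientedEdge K u w + orientedEdge K w v) := by
    intro u v w
    rw [orientedEdge_symm u v, orientedEdge_symm w u, orientedEdge_symm v w]
    abel
  have rot : ∀ {u v w : ι}, orientedEdge K u v + orientedEdge K v w + orientedEdge K w u =
      orientedEdge K v w + orientedEdge K w u + orientedEdge K u v := by
    intro u v w; abel
  rcases lt_trichotomy u v with huv | rfl | huv
  · rcases lt_trichotomy v w with hvw | rfl | hvw
    · exact key h huv hvw
    · rw [orientedEdge_self, orientedEdge_symm u v]; simp
    · rcases lt_trichotomy u w with huw | rfl | huw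
      · rw [rot, rot, swap]
        exact Submodule.neg_mem _ (key (by convert h using 1; ext; simp; tauto) huw hvw)
      · rw [orientedEdge_self, orientedEdge_symm u v]; simp
      · rw [rot, rot]
        exact key (by convert h using 1; ext; simp; tauto) huw huv
  · rw [orientedEdge_self, orientedEdge_symm u w]; simp
  · rcases lt_trichotomy u w with huw | rfl | huw
    · rw [swap]
      exact Submodule.neg_mem _ (key (by convert h using 1; ext; simp; tauto) huv huw)
    · rw [orientedEdge_self, orientedEdge_symm u v]; simp
    · rcases lt_trichotomy v w with hvw | rfl | hvw
      · rw [rot]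
        exact key (by convert h using 1; ext; simp; tauto) hvw huw
      · rw [orientedEdge_self, orientedEdge_symm u v]; simp
      · rw [rot, swap]
        exact Submodule.neg_mem _ (key (by convert h using 1; ext; simp; tauto) hvw huv)

/-- Boundaries have coefficient `0` on an edge that lies in no triangle. -/
theorem boundaries_apply_eq_zero {u v : ι} (huv : u < v)
    (h : ∀ w, w ≠ u → w ≠ v → ({u, v, w} : Finset ι) ∉ X) {z : Chain K ι 1}
    (hz : z ∈ boundaries K X 1) : z (pairEmb huv) = 0 := by
  obtain ⟨y, hy, rfl⟩ := hz
  rw [boundary, Finsupp.lsum_apply, Finsupp.sum, Finsupp.finsetSum_apply]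
  refine Finset.sum_eq_zero fun σ hσ => ?_
  have hσX : Finset.univ.map σ.toEmbedding ∈ X := hy hσ
  rw [LinearMap.sum_apply, Finsupp.finsetSum_apply]
  refine Finset.sum_eq_zero fun i _ => ?_
  rw [LinearMap.smul_apply, Finsupp.lsingle_apply, Finsupp.smul_apply, Finsupp.single_apply,
    if_neg, smul_zero]
  intro hi
  have hu : σ (i.succAbove 0) = u := congrArg (fun f => f 0) hi
  have hv : σ (i.succAbove 1) = v := congrArg (fun f => f 1) hi
  refine h (σ i) ?_ ?_ ?_
  · rw [← hu]; exact fun e => Fin.succAbove_ne i 0 (σ.injective e).symm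
  · rw [← hv]; exact fun e => Fin.succAbove_ne i 1 (σ.injective e).symm
  · convert hσX using 1
    rw [← hu, ← hv]
    ext x
    simp only [Finset.mem_insert, Finset.mem_singleton, Finset.mem_map, Finset.mem_univ, true_and]
    constructor
    · rintro (rfl | rfl | rfl) <;> exact ⟨_, rfl⟩
    · rintro ⟨j, rfl⟩
      fin_cases i <;> fin_cases j <;> simp [Fin.succAbove]

end Edges

/-! ### Killing cycles by elimination of vertices -/

section Elimination

variable {K : Type u} [Field K] {ι : Type} [LinearOrder ι] [Finite ι]
  {X : AbstractSimplicialComplex ι}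

/-- Let the vertices be eliminated in the order of increasing `r`, and suppose that whenever `v` is
eliminated, all its later `Y`-neighbours are dominated by one later vertex `w`. Then an
antisymmetric function `f` of pairs of vertices that is additive on the triangles of `X` is the
difference of a potential along the edges of `Y`. -/
theorem exists_potential (f : ι → ι → K) (hf : ∀ u v, f v u = -f u v)
    (hX : ∀ u v w, ({u, v, w} : Finset ι) ∈ X → f u v + f v w + f w u = 0)
    (Y : ι → ι → Prop) (hY : ∀ u v, Y u v → Y v u) (r : ι → ℕ) (hr : r.Injective)
    (hdom : ∀ v, ∃ w, ∀ u, r v < r u → Y v u →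
      r v < r w ∧ (u = w ∨ Y w u ∧ ({v, w, u} : Finset ι) ∈ X)) :
    ∃ g : ι → K, ∀ u v, u ≠ v → Y u v → f u v = g v - g u := by
  classical
  have main : ∀ m n, (∀ v, r v < n + m) → ∃ g : ι → K, ∀ u v, n ≤ r u → n ≤ r v → u ≠ v →
      Y u v → f u v = g v - g u := by
    intro m
    induction m with
    | zero => intro n hn; exact ⟨0, fun u v hu => absurd (hn u) (not_lt.mpr hu)⟩
    | succ m ih =>
      intro n hn
      obtain ⟨g, hg⟩ := ih (n + 1) fun v => by have := hn v; omega
      by_cases hv : ∃ v, r v = n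
      · obtain ⟨v, rfl⟩ := hv
        obtain ⟨w, hw⟩ := hdom v
        have step : ∀ u, r v < r u → Y v u →
            f v u = Function.update g v (g w - f v w) u - Function.update g v (g w - f v w) v := by
          intro u hu hvu
          have huv : u ≠ v := fun h => by simp [h] at hu
          rw [Function.update_of_ne huv, Function.update_self]
          obtain ⟨hrw, rfl | ⟨hwu, hT⟩⟩ := hw u hu hvu
          · ring
          · by_cases hne : w = u
            · subst hne; ring
            · have h1 := hg w u hrw hu hne hwu
              have h2 := hX _ _ _ hT
              rw [hf v u] at h2
              linear_combination h1 - h2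
        refine ⟨Function.update g v (g w - f v w), fun a b ha hb hab hYab => ?_⟩
        by_cases hav : a = v
        · subst hav
          exact step b (lt_of_le_of_ne hb (hr.ne hab)) hYab
        · by_cases hbv : b = v
          · subst hbv
            rw [hf b a, step a (lt_of_le_of_ne ha (hr.ne hab.symm)) (hY _ _ hYab)]
            ring
          · rw [Function.update_of_ne hav, Function.update_of_ne hbv]
            exact hg a b (lt_of_le_of_ne ha (hr.ne (Ne.symm hav)))
              (lt_of_le_of_ne hb (hr.ne (Ne.symm hbv))) hab hYab
      · push Not at hv
        exact ⟨g, fun a b ha hb => hg a b (lt_of_le_of_ne ha (hv a).symm)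
          (lt_of_le_of_ne hb (hv b).symm)⟩
  obtain ⟨m, hm⟩ := (Set.finite_range r).bddAbove
  obtain ⟨g, hg⟩ := main (m + 1) 0 fun v => by
    have := hm (Set.mem_range_self v)
    omega
  exact ⟨g, fun u v => hg u v (Nat.zero_le _) (Nat.zero_le _)⟩

/-- A cycle supported on a graph `Y` whose vertices can be eliminated one by one by domination, as
in `exists_potential`, is a boundary. -/
theorem mem_boundaries_of_elimination (Y : ι → ι → Prop) (hY : ∀ u v, Y u v → Y v u)
    (r : ι → ℕ) (hr : r.Injective)
    (hdom : ∀ v, ∃ w, ∀ u, r v < r u → Y v u →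
      r v < r w ∧ (u = w ∨ Y w u ∧ ({v, w, u} : Finset ι) ∈ X))
    {z : Chain K ι 1} (hz : z ∈ cycles K X 1) (hzY : ∀ σ, z σ ≠ 0 → Y (σ 0) (σ 1)) :
    z ∈ boundaries K X 1 := by
  by_contra hzb
  -- A linear form that vanishes on the boundaries is a cocycle.
  obtain ⟨f, hfz, hf⟩ := Submodule.exists_le_ker_of_notMem hzb
  obtain ⟨g, hg⟩ := exists_potential (X := X) (fun u v => f (orientedEdge K u v))
    (fun u v => by rw [orientedEdge_symm, map_neg])
    (fun u v w h => by
      rw [← map_add, ← map_add]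
      exact hf (triangle_mem_boundaries h)) Y hY r hr hdom
  apply hfz
  have hG : ∀ y ∈ Finsupp.supported K K {σ : Fin 2 ↪o ι | Y (σ 0) (σ 1)},
      f y = Finsupp.linearCombination K (fun τ : Fin 1 ↪o ι => g (τ 0)) (boundary K 0 y) := by
    intro y hy
    rw [Finsupp.supported_eq_span_single] at hy
    induction hy using Submodule.span_induction with
    | mem y hy =>
      obtain ⟨σ, hσ, rfl⟩ := hy
      have h01 : σ 0 < σ 1 := σ.strictMono (by decide)
      have := hg _ _ h01.ne hσ
      beta_reduce
      rw [emb_eq_pairEmb σ, ← orientedEdge_of_lt, this, boundary_orientedEdge]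
      simp [vertexChain]
    | zero => simp
    | add x y _ _ hx hy => rw [map_add, map_add, map_add, hx, hy]
    | smul a x _ hx => rw [map_smul, map_smul, map_smul, hx]
  rw [hG z ?_, LinearMap.mem_ker.mp hz.2, map_zero]
  intro σ hσ
  exact hzY σ (Finsupp.mem_support_iff.mp hσ)

end Elimination

/-! ### Admissible sequences -/

section Admissible

theorem sqrt_two_bounds : 1.414 < √2 ∧ √2 < 1.415 :=
  ⟨Real.lt_sqrt_of_sq_lt (by norm_num), (Real.sqrt_lt' (by norm_num)).mpr (by norm_num)⟩

/-- The powers of a number `q` with `q ^ 2 < √2 < q ^ 3` form an admissible sequence. -/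
theorem admissible_pow (c : ℕ) : Admissible c fun n => (1.15 : ℝ) ^ n := by
  obtain ⟨h1, h2⟩ := sqrt_two_bounds
  refine ⟨fun n _ => pow_lt_pow_right₀ (by norm_num) (Nat.lt_succ_self n), pow_zero _,
    ⟨by norm_num, by norm_num; linarith⟩, fun _ => ⟨by norm_num, by norm_num; linarith⟩,
    fun n hn _ => ?_⟩
  obtain ⟨m, rfl⟩ := Nat.exists_eq_add_of_le' hn
  have hm : (0 : ℝ) < 1.15 ^ m := by positivity
  simp only [Nat.add_sub_cancel, show m + 3 - 2 = m + 1 by omega, pow_add]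
  constructor <;> nlinarith

variable {c : ℕ} {ε : ℕ → ℝ} (h : Admissible c ε)
include h

theorem Admissible.le_of_le {i j : ℕ} (hij : i ≤ j) (hj : j ≤ c + 1) : ε i ≤ ε j := by
  induction j, hij using Nat.le_induction with
  | base => exact le_rfl
  | succ j _ ih => exact (ih (by omega)).trans (h.increasing j (by omega)).le

theorem Admissible.lt_of_lt {i j : ℕ} (hij : i < j) (hj : j ≤ c + 1) : ε i < ε j :=
  (h.increasing i (by omega)).trans_le (h.le_of_le hij hj)

theorem Admissible.pos {i : ℕ} (hi : i ≤ c + 1) : 0 < ε i := by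
  have := h.le_of_le (Nat.zero_le i) hi
  rw [h.zero] at this
  linarith

theorem Admissible.lt_sqrt_two_mul_sub_two {i : ℕ} (hi : i + 2 ≤ c + 1) :
    ε (i + 2) < √2 * ε i := by
  rcases Nat.eq_zero_or_pos i with rfl | hi'
  · exact (h.two (by omega)).2
  · exact (h.step (i + 2) (by omega) hi).2

theorem Admissible.sqrt_two_mul_sub_three_lt {i : ℕ} (hi : i + 3 ≤ c + 1) :
    √2 * ε i < ε (i + 3) :=
  (h.step (i + 3) (by omega) hi).1

theorem Admissible.lt_sqrt_two_mul_sub_one {i : ℕ} (hi : i ≤ c) : ε (i + 1) < √2 * ε i := by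
  rcases Nat.eq_zero_or_pos i with rfl | hi'
  · rw [h.zero, mul_one]; exact h.one.2
  · obtain ⟨i, rfl⟩ := Nat.exists_eq_add_of_le' hi'
    exact (h.lt_sqrt_two_mul_sub_two (by omega)).trans
      (mul_lt_mul_of_pos_left (h.lt_of_lt (Nat.lt_succ_self i) (by omega)) (by positivity))

end Admissible

/-! ### Proximity in the point cloud -/

section Geometry

/-- Half of the abscissa of the column `n` of the point cloud. -/
def abscissa (ε : ℕ → ℝ) (n : ℕ) : ℝ := ∑ i ∈ Finset.range n, ε i

theorem abscissa_succ (ε : ℕ → ℝ) (n : ℕ) : abscissa ε (n + 1) = abscissa ε n + ε n :=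
  Finset.sum_range_succ _ _

variable {c : ℕ} {ε : ℕ → ℝ}

theorem Admissible.abscissa_le (h : Admissible c ε) {i j : ℕ} (hij : i ≤ j) (hj : j ≤ c + 2) :
    abscissa ε i ≤ abscissa ε j :=
  Finset.sum_le_sum_of_subset_of_nonneg (Finset.range_mono hij) fun k hk _ =>
    (h.pos (by have := Finset.mem_range.mp hk; omega)).le

theorem Admissible.abscissa_add_le (h : Admissible c ε) {i j : ℕ} (hij : i < j)
    (hj : j ≤ c + 2) : abscissa ε i + ε i ≤ abscissa ε j := by
  rw [← abscissa_succ]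
  exact h.abscissa_le hij hj

theorem Admissible.abscissa_add_two_mul_le (h : Admissible c ε) {i j : ℕ} (hij : i + 2 ≤ j)
    (hj : j ≤ c + 1) : abscissa ε i + 2 * ε i ≤ abscissa ε j := by
  have h1 := h.abscissa_add_le (i := i + 1) (j := j) (by omega) (by omega)
  have h2 := h.le_of_le (i := i) (j := i + 1) (by omega) (by omega)
  rw [abscissa_succ] at h1
  linarith

/-- Across two or more columns, the abscissa grows by at least the height that is reached. -/
theorem Admissible.abscissa_add_height_le (h : Admissible c ε) {i j : ℕ} (hij : i + 2 ≤ j)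
    (hj : j ≤ c + 1) : abscissa ε i + ε j ≤ abscissa ε j := by
  obtain ⟨j, rfl⟩ := Nat.exists_eq_add_of_le' (show 2 ≤ j by omega)
  have h1 := h.abscissa_le (i := i) (j := j) (by omega) (by omega)
  have h2 := h.lt_sqrt_two_mul_sub_two hj
  have h3 := h.le_of_le (i := j) (j := j + 1) (by omega) (by omega)
  have h4 := h.pos (i := j) (by omega)
  have h5 := sqrt_two_bounds.2
  rw [abscissa_succ, abscissa_succ]
  nlinarith

/-- Half of the ordinate of a point of the cloud. -/
def height (ε : ℕ → ℝ) (p : Fin (c + 2) ×ₗ Fin 2) : ℝ :=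
  if (ofLex p).2 = 0 then 0 else ε (ofLex p).1

/-- The points `p` and `q` of the cloud have distance at most `2 * s`. -/
def Near (ε : ℕ → ℝ) (s : ℝ) (p q : Fin (c + 2) ×ₗ Fin 2) : Prop :=
  (abscissa ε (ofLex p).1 - abscissa ε (ofLex q).1) ^ 2 + (height ε p - height ε q) ^ 2 ≤ s ^ 2

/-- The point of the column `n` on the horizontal axis. -/
def bot (n : Fin (c + 2)) : Fin (c + 2) ×ₗ Fin 2 := toLex (n, 0)

/-- The point of the column `n` above the horizontal axis. -/
def top (n : Fin (c + 2)) : Fin (c + 2) ×ₗ Fin 2 := toLex (n, 1)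

theorem eq_bot_or_eq_top (p : Fin (c + 2) ×ₗ Fin 2) : ∃ n, p = bot n ∨ p = top n := by
  obtain ⟨n, b⟩ := p
  refine ⟨n, ?_⟩
  fin_cases b
  · exact Or.inl rfl
  · exact Or.inr rfl

theorem bot_ne_top (i j : Fin (c + 2)) : bot i ≠ top j := fun h => by
  have := congrArg (fun p => (ofLex p).2) h
  simp [bot, top] at this

theorem bot_inj {i j : Fin (c + 2)} : bot i = bot j ↔ i = j :=
  ⟨fun h => congrArg (fun p => (ofLex p).1) h, fun h => h ▸ rfl⟩

theorem top_inj {i j : Fin (c + 2)} : top i = top j ↔ i = j :=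
  ⟨fun h => congrArg (fun p => (ofLex p).1) h, fun h => h ▸ rfl⟩

theorem top_lt_top {i j : Fin (c + 2)} (hij : i < j) : top i < top j :=
  Prod.Lex.toLex_lt_toLex.mpr (Or.inl hij)

variable {s : ℝ}

theorem Near.symm {p q : Fin (c + 2) ×ₗ Fin 2} (h : Near ε s p q) : Near ε s q p := by
  unfold Near at *; linarith

theorem near_bot_bot {i j : Fin (c + 2)} :
    Near ε s (bot i) (bot j) ↔ (abscissa ε i - abscissa ε j) ^ 2 ≤ s ^ 2 := by
  simp [Near, bot, height]

theorem near_bot_top {i j : Fin (c + 2)} : Near ε s (bot i) (top j) ↔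
    (abscissa ε i - abscissa ε j) ^ 2 + (ε j) ^ 2 ≤ s ^ 2 := by
  simp [Near, bot, top, height]

theorem near_top_bot {i j : Fin (c + 2)} : Near ε s (top i) (bot j) ↔
    (abscissa ε i - abscissa ε j) ^ 2 + (ε i) ^ 2 ≤ s ^ 2 := by
  simp [Near, bot, top, height]

theorem near_top_top {i j : Fin (c + 2)} : Near ε s (top i) (top j) ↔
    (abscissa ε i - abscissa ε j) ^ 2 + (ε i - ε j) ^ 2 ≤ s ^ 2 := by
  simp [Near, top, height]

theorem Near.abscissa_le {p q : Fin (c + 2) ×ₗ Fin 2} (hs : 0 ≤ s) (h : Near ε s p q) :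
    abscissa ε (ofLex q).1 ≤ abscissa ε (ofLex p).1 + s := by
  have h' : (abscissa ε (ofLex p).1 - abscissa ε (ofLex q).1) ^ 2 ≤ s ^ 2 := by
    unfold Near at h; nlinarith [sq_nonneg (height ε p - height ε q)]
  have := (abs_le_of_sq_le_sq' h' hs).1
  linarith

theorem closedBall_inter_nonempty_iff (hs : 0 ≤ s) (p q : Fin (c + 2) ×ₗ Fin 2) :
    (Metric.closedBall (pointCloud c ε p) s ∩ Metric.closedBall (pointCloud c ε q) s).Nonempty ↔
      Near ε s p q := by
  rw [← Set.not_disjoint_iff_nonempty_inter, disjoint_closedBall_closedBall_iff hs hs, not_lt,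
    EuclideanSpace.dist_eq, Real.sqrt_le_left (by linarith), Fin.sum_univ_two, Near, Real.dist_eq,
    Real.dist_eq, sq_abs, sq_abs]
  have h0 : ∀ p, pointCloud c ε p 0 = 2 * abscissa ε (ofLex p).1 := fun p => rfl
  have h1 : ∀ p, pointCloud c ε p 1 = 2 * height ε p := fun p => by
    simp only [pointCloud, height]
    split_ifs <;> simp
  rw [h0, h0, h1, h1]
  constructor <;> intro h <;> nlinarith

theorem mem_vietorisRips_iff {t : ℝ≥0} {σ : Finset (Fin (c + 2) ×ₗ Fin 2)} :
    σ ∈ vietorisRips (pointCloud c ε) t ↔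
      σ.Nonempty ∧ (σ : Set (Fin (c + 2) ×ₗ Fin 2)).Pairwise (Near ε t) := by
  change σ.Nonempty ∧ (σ : Set (Fin (c + 2) ×ₗ Fin 2)).Pairwise _ ↔ _
  simp only [closedBall_inter_nonempty_iff t.coe_nonneg]

theorem Near.mem_vietorisRips {t : ℝ≥0} {p q : Fin (c + 2) ×ₗ Fin 2} (h : Near ε t p q) :
    {p, q} ∈ vietorisRips (pointCloud c ε) t := by
  rw [mem_vietorisRips_iff]
  refine ⟨by simp, ?_⟩
  rw [Finset.coe_pair, Set.pairwise_pair]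
  exact fun _ => ⟨h, h.symm⟩

theorem triple_mem_vietorisRips {t : ℝ≥0} {p q r : Fin (c + 2) ×ₗ Fin 2} (h : Near ε t p q)
    (h' : Near ε t q r) (h'' : Near ε t p r) : {p, q, r} ∈ vietorisRips (pointCloud c ε) t := by
  rw [mem_vietorisRips_iff]
  refine ⟨by simp, ?_⟩
  rintro a ha b hb hab
  simp only [Finset.coe_insert, Finset.coe_singleton, Set.mem_insert_iff,
    Set.mem_singleton_iff] at ha hb
  rcases ha with rfl | rfl | rfl <;> rcases hb with rfl | rfl | rfl <;>
    first | exact absurd rfl hab | assumption | exact Near.symm (by assumption)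

variable (h : Admissible c ε)
include h

theorem Admissible.sqrt_two_mul_sq {i : ℕ} (hi : i ≤ c + 1) :
    0 < √2 * ε i ∧ (√2 * ε i) ^ 2 = 2 * ε i ^ 2 := by
  refine ⟨mul_pos (by positivity) (h.pos hi), ?_⟩
  rw [mul_pow, Real.sq_sqrt (by norm_num)]

theorem Admissible.not_near_of_add_two_le (hs : 0 ≤ s) {p q : Fin (c + 2) ×ₗ Fin 2}
    (hpq : ((ofLex p).1 : ℕ) + 2 ≤ (ofLex q).1) (hlt : s < √2 * ε (ofLex p).1) :
    ¬ Near ε s p q := fun hn => by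
  have h1 := h.abscissa_add_two_mul_le hpq (by omega)
  have h2 := hn.abscissa_le hs
  have h3 := h.pos (i := (ofLex p).1) (by omega)
  have h4 := sqrt_two_bounds.2
  nlinarith

theorem Admissible.near_bot_top_same (hs : 0 ≤ s) {i : Fin (c + 2)} :
    Near ε s (bot i) (top i) ↔ ε i ≤ s := by
  have := h.pos (i := i) (by omega)
  rw [near_bot_top, sub_self, zero_pow two_ne_zero, zero_add, sq_le_sq₀ this.le hs]

theorem Admissible.near_bot_bot_succ (hs : 0 ≤ s) {i j : Fin (c + 2)} (hij : (i : ℕ) + 1 = j) :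
    Near ε s (bot i) (bot j) ↔ ε i ≤ s := by
  have := h.pos (i := i) (by omega)
  rw [near_bot_bot, ← hij, abscissa_succ, ← sq_le_sq₀ this.le hs]
  ring_nf

theorem Admissible.near_top_bot_succ (hs : 0 ≤ s) {i j : Fin (c + 2)} (hij : (i : ℕ) + 1 = j) :
    Near ε s (top i) (bot j) ↔ √2 * ε i ≤ s := by
  obtain ⟨h1, h2⟩ := h.sqrt_two_mul_sq (i := i) (by omega)
  rw [near_top_bot, ← hij, abscissa_succ, ← sq_le_sq₀ h1.le hs, h2]
  ring_nf

theorem Admissible.not_near_bot_top_succ (hs : 0 ≤ s) {i j : Fin (c + 2)}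
    (hij : (i : ℕ) + 1 = j) (hlt : s < √2 * ε i) : ¬ Near ε s (bot i) (top j) := by
  obtain ⟨h1, h2⟩ := h.sqrt_two_mul_sq (i := i) (by omega)
  have h3 := h.pos (i := i) (by omega)
  have h4 := h.lt_of_lt (i := i) (j := j) (by omega) (by omega)
  rw [near_bot_top, ← hij, abscissa_succ, hij]
  nlinarith

theorem Admissible.near_top_top_succ {i j : Fin (c + 2)}
    (hij : (i : ℕ) + 1 = j) (hle : ε j ≤ s) : Near ε s (top i) (top j) := by
  have h3 := h.pos (i := i) (by omega)
  have h4 := h.lt_of_lt (i := i) (j := j) (by omega) (by omega)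
  rw [near_top_top, ← hij, abscissa_succ, hij]
  nlinarith

/-- Before the vertical edge of the column `j` is born, the upper point of the column has at most
one neighbour, the upper point of the preceding column. -/
theorem Admissible.eq_top_of_near_top (hs : 0 ≤ s) {j : Fin (c + 2)} (hlt : s < ε j)
    {p : Fin (c + 2) ×ₗ Fin 2} (hp : p ≠ top j) (hn : Near ε s (top j) p) :
    ∃ i : Fin (c + 2), (i : ℕ) + 1 = j ∧ p = top i := by
  obtain ⟨i, rfl | rfl⟩ := eq_bot_or_eq_top p
  · rw [near_top_bot] at hn
    nlinarith [sq_nonneg (abscissa ε j - abscissa ε i)]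
  · refine ⟨i, ?_, rfl⟩
    have hne : (i : ℕ) ≠ j := fun e => hp (by rw [Fin.ext e])
    by_contra hne'
    rcases Nat.lt_or_ge i j with hij | hij
    · have h1 := h.abscissa_add_height_le (i := i) (j := j) (by omega) (by omega)
      have h2 := hn.symm.abscissa_le hs
      change abscissa ε j ≤ abscissa ε i + s at h2
      linarith
    · have h1 := h.abscissa_add_le (i := j) (j := i) (by omega) (by omega)
      have h2 := hn.abscissa_le hs
      change abscissa ε i ≤ abscissa ε j + s at h2
      linarith

/-- Once the diagonal from `top i` to `bot (i + 1)` is born, the latter point dominates the column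
`i` among the points of the columns from `i` on. -/
theorem Admissible.near_bot_of_near (hs : 0 ≤ s) {i j : Fin (c + 2)} (hij : (i : ℕ) + 1 = j)
    (hle : √2 * ε i ≤ s) {p q : Fin (c + 2) ×ₗ Fin 2} (hp : (ofLex p).1 = i)
    (hq : i ≤ (ofLex q).1) (hn : Near ε s p q) : Near ε s (bot j) q := by
  have h0 := h.pos (i := i) (by omega)
  have h1 := h.lt_sqrt_two_mul_sub_one (i := i) (by omega)
  have h2 := sqrt_two_bounds.1
  rcases hq.eq_or_lt with hq | hq
  · obtain ⟨k, rfl | rfl⟩ := eq_bot_or_eq_top q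
    · obtain rfl : i = k := hq
      exact ((h.near_bot_bot_succ hs hij).mpr (by nlinarith)).symm
    · obtain rfl : i = k := hq
      exact ((h.near_top_bot_succ hs hij).mpr hle).symm
  · have hj : abscissa ε j = abscissa ε i + ε i := by rw [← hij, abscissa_succ]
    have h3 := h.abscissa_add_le (i := i) (j := (ofLex q).1) hq (by omega)
    have h4 : ε j < √2 * ε i := by rw [← hij]; exact h1
    have h5 := h.pos (i := j) (by omega)
    obtain ⟨k, rfl | rfl⟩ := eq_bot_or_eq_top p
    · obtain rfl : k = i := hp
      have e : height ε (bot k) = height ε (bot j) := rfl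
      unfold Near at hn ⊢
      rw [e] at hn
      change (abscissa ε k - _) ^ 2 + _ ≤ _ at hn
      change (abscissa ε j - _) ^ 2 + _ ≤ _
      rw [hj]
      nlinarith
    · obtain rfl : k = i := hp
      obtain ⟨l, rfl | rfl⟩ := eq_bot_or_eq_top q
      · change k < l at hq
        change abscissa ε k + ε k ≤ abscissa ε l at h3
        rw [near_top_bot] at hn
        rw [near_bot_bot, hj]
        nlinarith
      · change k < l at hq
        change abscissa ε k + ε k ≤ abscissa ε l at h3
        rw [near_top_top] at hn
        rw [near_bot_top, hj]
        by_cases hl : (k : ℕ) + 1 = l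
        · obtain rfl : j = l := Fin.ext (hij.symm.trans hl)
          rw [hj]
          nlinarith
        · have h6 := h.abscissa_add_height_le (i := k) (j := l) (by omega) (by omega)
          nlinarith

/-- As long as the square between the columns `i` and `i + 1` is not filled, its upper edge lies in
no triangle. -/
theorem Admissible.not_near_of_near_top (hs : 0 ≤ s) {i j : Fin (c + 2)} (hij : (i : ℕ) + 1 = j)
    (hlt : s < √2 * ε i) {p : Fin (c + 2) ×ₗ Fin 2} (hpi : p ≠ top i) (hpj : p ≠ top j)
    (hni : Near ε s (top i) p) : ¬ Near ε s (top j) p := by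
  intro hnj
  have h0 := h.pos (i := i) (by omega)
  have h2 := sqrt_two_bounds
  obtain ⟨k, hk⟩ := eq_bot_or_eq_top p
  have hpk : (ofLex p).1 = k := by rcases hk with rfl | rfl <;> rfl
  rcases lt_trichotomy (k : ℕ) i with hki | hki | hki
  · have h3 := h.abscissa_add_le (i := k) (j := i) hki (by omega)
    have h4 := hnj.symm.abscissa_le hs
    rw [hpk] at h4
    change abscissa ε j ≤ _ at h4
    obtain ⟨l, hl⟩ : ∃ l, (i : ℕ) = l + 1 := ⟨i - 1, by omega⟩
    have h5 := h.lt_sqrt_two_mul_sub_one (i := l) (by omega)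
    have h6 := h.abscissa_add_le (i := l) (j := i) (by omega) (by omega)
    have h7 := h.abscissa_le (i := k) (j := l) (by omega) (by omega)
    rw [← hij, abscissa_succ] at h4
    rw [← hl] at h5
    nlinarith
  · obtain rfl : k = i := Fin.ext hki
    rcases hk with rfl | rfl
    · exact h.not_near_bot_top_succ hs hij hlt hnj.symm
    · exact hpi rfl
  · rcases eq_or_ne (k : ℕ) j with hkj | hkj
    · obtain rfl : k = j := Fin.ext hkj
      rcases hk with rfl | rfl
      · exact not_le.mpr hlt ((h.near_top_bot_succ hs hij).mp hni)
      · exact hpj rfl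
    · refine h.not_near_of_add_two_le hs (p := top i) (q := p) ?_ hlt hni
      rw [hpk]
      change (i : ℕ) + 2 ≤ k
      omega

theorem Admissible.injective_pointCloud : Function.Injective (pointCloud c ε) := by
  intro p q hpq
  have hn : Near ε 0 p q := by
    rw [← closedBall_inter_nonempty_iff le_rfl, hpq]
    simp
  have key : ∀ p q : Fin (c + 2) ×ₗ Fin 2, Near ε 0 p q → (ofLex p).1 ≤ (ofLex q).1 := by
    intro p q hn
    by_contra! hlt
    have h1 := h.abscissa_add_le (i := (ofLex q).1) (j := (ofLex p).1) hlt (by omega)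
    have h2 := hn.symm.abscissa_le le_rfl
    have h3 := h.pos (i := (ofLex q).1) (by omega)
    linarith
  have hcol := le_antisymm (key p q hn) (key q p hn.symm)
  obtain ⟨i, hi⟩ := eq_bot_or_eq_top p
  obtain ⟨j, hj⟩ := eq_bot_or_eq_top q
  have hpi := h.pos (i := i) (by omega)
  rcases hi with rfl | rfl <;> rcases hj with rfl | rfl <;> obtain rfl : i = j := hcol
  · rfl
  · exact absurd ((h.near_bot_top_same le_rfl).mp hn) (not_le.mpr hpi)
  · exact absurd ((h.near_bot_top_same le_rfl).mp hn.symm) (not_le.mpr hpi)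
  · rfl

end Geometry

/-! ### The first homology of the Vietoris-Rips complexes -/

section Squares

variable {K : Type u} [Field K] {c : ℕ} {ε : ℕ → ℝ}

variable (K) in
/-- The boundary of the square between the columns `k` and `k + 1`, starting with its upper edge,
as a chain. -/
def squareChain (k : Fin (c + 1)) : Chain K (Fin (c + 2) ×ₗ Fin 2) 1 :=
  orientedEdge K (top k.castSucc) (top k.succ) + orientedEdge K (top k.succ) (bot k.succ) +
    orientedEdge K (bot k.succ) (bot k.castSucc) + orientedEdge K (bot k.castSucc) (top k.castSucc)

/-- The upper edge of the square between the columns `k` and `k + 1`. -/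
def upperEdge (k : Fin (c + 1)) : Fin 2 ↪o Fin (c + 2) ×ₗ Fin 2 :=
  pairEmb (top_lt_top k.castSucc_lt_succ)

theorem squareChain_apply_upperEdge (k l : Fin (c + 1)) :
    squareChain K k (upperEdge l) = if k = l then 1 else 0 := by
  have key : ∀ (p : Fin (c + 2) ×ₗ Fin 2) (i : Fin (c + 2)),
      orientedEdge K p (bot i) (upperEdge l) = 0 := by
    intro p i
    unfold orientedEdge
    split_ifs with h h
    · rw [Finsupp.single_apply, if_neg]
      exact fun e => bot_ne_top _ _ (congrArg (fun f => f 1) e)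
    · rw [Finsupp.neg_apply, Finsupp.single_apply, if_neg, neg_zero]
      exact fun e => bot_ne_top _ _ (congrArg (fun f => f 0) e)
    · rfl
  have h1 : orientedEdge K (top k.castSucc) (top k.succ) (upperEdge l) =
      if k = l then 1 else 0 := by
    rw [orientedEdge_of_lt (top_lt_top k.castSucc_lt_succ), Finsupp.single_apply]
    congr 1
    refine propext ⟨fun e => ?_, fun e => e ▸ rfl⟩
    exact Fin.castSucc_injective _ (top_inj.mp (congrArg (fun f => f 0) e))
  rw [squareChain, orientedEdge_symm (top k.castSucc) (bot k.castSucc)]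
  simp [key, h1]

theorem sum_smul_squareChain_apply (a : Fin (c + 1) → K) (l : Fin (c + 1)) :
    (∑ k, a k • squareChain K k) (upperEdge l) = a l := by
  simp [Finsupp.finsetSum_apply, squareChain_apply_upperEdge]

variable (h : Admissible c ε)
include h

theorem Admissible.squareChain_mem_cycles {k : Fin (c + 1)} {s : ℝ≥0} (hs : ε (k + 1) ≤ s) :
    squareChain K k ∈ cycles K (vietorisRips (pointCloud c ε) s) 1 := by
  have hk : ε k ≤ s := (h.increasing k (by omega)).le.trans hs
  constructor
  · refine Submodule.add_mem _ (Submodule.add_mem _ (Submodule.add_mem _ ?_ ?_) ?_) ?_ <;>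
      refine orientedEdge_mem_chains (Near.mem_vietorisRips ?_)
    · exact h.near_top_top_succ rfl hs
    · exact ((h.near_bot_top_same s.coe_nonneg).mpr hs).symm
    · exact ((h.near_bot_bot_succ s.coe_nonneg rfl).mpr hk).symm
    · exact (h.near_bot_top_same s.coe_nonneg).mpr hk
  · refine LinearMap.mem_ker.mpr ?_
    rw [squareChain]
    simp only [map_add, boundary_orientedEdge]
    abel

/-- The diagonal from `top k` to `bot (k + 1)` cuts the square into two triangles. -/
theorem Admissible.squareChain_mem_boundaries {k : Fin (c + 1)} {s : ℝ≥0} (hs : √2 * ε k ≤ s) :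
    squareChain K k ∈ boundaries K (vietorisRips (pointCloud c ε) s) 1 := by
  have hk1 : ε (k + 1) ≤ s := (h.lt_sqrt_two_mul_sub_one (by omega)).le.trans hs
  have hk : ε k ≤ s := (h.increasing k (by omega)).le.trans hk1
  have h1 : Near ε s (top k.castSucc) (top k.succ) := h.near_top_top_succ rfl hk1
  have h2 : Near ε s (top k.succ) (bot k.succ) :=
    ((h.near_bot_top_same s.coe_nonneg).mpr hk1).symm
  have h3 : Near ε s (bot k.succ) (bot k.castSucc) :=
    ((h.near_bot_bot_succ s.coe_nonneg rfl).mpr hk).symm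
  have h4 : Near ε s (bot k.castSucc) (top k.castSucc) :=
    (h.near_bot_top_same s.coe_nonneg).mpr hk
  have h5 : Near ε s (top k.castSucc) (bot k.succ) :=
    (h.near_top_bot_succ s.coe_nonneg rfl).mpr hs
  have e := Submodule.add_mem _
    (triangle_mem_boundaries (K := K) (triple_mem_vietorisRips h1 h2 h5))
    (triangle_mem_boundaries (K := K) (triple_mem_vietorisRips h5 h3 h4.symm))
  convert e using 1
  rw [squareChain, orientedEdge_symm (top k.castSucc) (bot k.succ)]
  abel

/-- A boundary involves no upper edge of an unfilled square. -/
theorem Admissible.boundaries_apply_upperEdge {k : Fin (c + 1)} {s : ℝ≥0} (hs : s < √2 * ε k)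
    {z : Chain K (Fin (c + 2) ×ₗ Fin 2) 1}
    (hz : z ∈ boundaries K (vietorisRips (pointCloud c ε) s) 1) : z (upperEdge k) = 0 := by
  refine boundaries_apply_eq_zero _ (fun p hp hp' hmem => ?_) hz
  have hn := (mem_vietorisRips_iff.mp hmem).2
  exact h.not_near_of_near_top s.coe_nonneg (i := k.castSucc) (j := k.succ) rfl hs hp hp'
    (hn (by simp) (by simp) hp.symm) (hn (by simp) (by simp) hp'.symm)

end Squares

section Spanning

variable {K : Type u} [Field K] {c : ℕ} {ε : ℕ → ℝ}

/-- The edges at scale `s`, without the upper edges of the unfilled squares. -/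
def Uncut (c : ℕ) (ε : ℕ → ℝ) (s : ℝ) (p q : Fin (c + 2) ×ₗ Fin 2) : Prop :=
  Near ε s p q ∧ ∀ k : Fin (c + 1), ε (k + 1) ≤ s → s < √2 * ε k →
    ¬ (p = top k.castSucc ∧ q = top k.succ) ∧ ¬ (q = top k.castSucc ∧ p = top k.succ)

open Classical in
/-- The position at which a point is eliminated at scale `s`: first the upper points of the columns
whose vertical edge is not yet present, then the other points column by column, the upper point
before the lower one. -/
def elimRank (c : ℕ) (ε : ℕ → ℝ) (s : ℝ) (p : Fin (c + 2) ×ₗ Fin 2) : ℕ :=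
  if (ofLex p).2 = 0 then 2 * (ofLex p).1 + 1 + (c + 2)
  else if ε (ofLex p).1 ≤ s then 2 * (ofLex p).1 + (c + 2) else (ofLex p).1

theorem elimRank_bot (s : ℝ) (i : Fin (c + 2)) :
    elimRank c ε s (bot i) = 2 * i + 1 + (c + 2) := by simp [elimRank, bot]

theorem elimRank_top_of_le {s : ℝ} {i : Fin (c + 2)} (h : ε i ≤ s) :
    elimRank c ε s (top i) = 2 * i + (c + 2) := by simp [elimRank, top, h]

theorem elimRank_top_of_lt {s : ℝ} {i : Fin (c + 2)} (h : s < ε i) :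
    elimRank c ε s (top i) = i := by simp [elimRank, top, h.not_ge]

theorem elimRank_injective (s : ℝ) : Function.Injective (elimRank c ε s) := by
  intro p q hpq
  obtain ⟨i, rfl | rfl⟩ := eq_bot_or_eq_top p <;> obtain ⟨j, rfl | rfl⟩ := eq_bot_or_eq_top q
  · rw [elimRank_bot, elimRank_bot] at hpq
    exact bot_inj.mpr (Fin.ext (by omega))
  · rcases le_or_gt (ε j) s with hj | hj
    · rw [elimRank_bot, elimRank_top_of_le hj] at hpq; omega
    · rw [elimRank_bot, elimRank_top_of_lt hj] at hpq; omega
  · rcases le_or_gt (ε i) s with hi | hi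
    · rw [elimRank_bot, elimRank_top_of_le hi] at hpq; omega
    · rw [elimRank_bot, elimRank_top_of_lt hi] at hpq; omega
  · rw [top_inj]
    rcases le_or_gt (ε i) s with hi | hi <;> rcases le_or_gt (ε j) s with hj | hj <;>
      simp only [elimRank_top_of_le, elimRank_top_of_lt, hi, hj] at hpq <;> exact Fin.ext (by omega)

theorem uncut_of_bot {s : ℝ} {i : Fin (c + 2)} {p : Fin (c + 2) ×ₗ Fin 2}
    (h : Near ε s (bot i) p) : Uncut c ε s (bot i) p :=
  ⟨h, fun _ _ _ => ⟨fun e => bot_ne_top _ _ e.1, fun e => bot_ne_top _ _ e.2⟩⟩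

/-- A point eliminated after a point of the column `j` whose vertical edge is present lies in
the column `j` or in a later one. -/
theorem le_column_of_elimRank_lt {s : ℝ} {j : Fin (c + 2)} {p : Fin (c + 2) ×ₗ Fin 2}
    (hr : 2 * (j : ℕ) + (c + 2) < elimRank c ε s p) : j ≤ (ofLex p).1 := by
  obtain ⟨i, rfl | rfl⟩ := eq_bot_or_eq_top p
  · rw [elimRank_bot] at hr
    change (j : ℕ) ≤ i
    omega
  · rcases le_or_gt (ε i) s with hi | hi
    · rw [elimRank_top_of_le hi] at hr
      change (j : ℕ) ≤ i
      omega
    · rw [elimRank_top_of_lt hi] at hr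
      omega

variable (h : Admissible c ε)
include h

/-- The hypothesis of `mem_boundaries_of_elimination` holds for the graph `Uncut`, in the order given
by `elimRank`. -/
theorem Admissible.exists_dominating {t : ℝ≥0} (p : Fin (c + 2) ×ₗ Fin 2) :
    ∃ w, ∀ q, elimRank c ε t p < elimRank c ε t q → Uncut c ε t p q →
      elimRank c ε t p < elimRank c ε t w ∧
        (q = w ∨ Uncut c ε t w q ∧ {p, w, q} ∈ vietorisRips (pointCloud c ε) t) := by
  have ht := t.coe_nonneg
  obtain ⟨j, hj⟩ := eq_bot_or_eq_top p
  have hpj : (ofLex p).1 = j := by rcases hj with rfl | rfl <;> rfl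
  by_cases hborn : p = top j ∧ t < ε j
  · -- The only possible neighbour of `p` is the upper point of the preceding column.
    obtain ⟨rfl, hlt⟩ := hborn
    refine ⟨top ⟨j - 1, by omega⟩, fun q hr hq => ?_⟩
    obtain ⟨i, hi, rfl⟩ := h.eq_top_of_near_top ht hlt (fun e => by simp [e] at hr) hq.1
    have hij : i = ⟨j - 1, by omega⟩ := Fin.ext (by simp only; omega)
    exact ⟨hij ▸ hr, Or.inl (congrArg top hij)⟩
  -- From here on, the points eliminated after `p` lie in the columns from `j` on.
  have hrank : 2 * (j : ℕ) + (c + 2) ≤ elimRank c ε t p := by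
    rcases hj with rfl | rfl
    · rw [elimRank_bot]; omega
    · rw [elimRank_top_of_le (by by_contra! hlt; exact hborn ⟨rfl, hlt⟩)]
  have hcol : ∀ q, elimRank c ε t p < elimRank c ε t q → j ≤ (ofLex q).1 := fun q hq =>
    le_column_of_elimRank_lt (hrank.trans_lt hq)
  by_cases hlast : (j : ℕ) = c + 1
  · -- In the last column, only the lower point can be left.
    refine ⟨bot j, fun q hr _ => ?_⟩
    obtain ⟨i, hi⟩ := eq_bot_or_eq_top q
    have hij : j = i := by
      have := hcol q hr
      rcases hi with rfl | rfl <;> exact le_antisymm this (Fin.le_def.mpr (by omega))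
    subst hij
    rcases hi with rfl | rfl
    · exact ⟨hr, Or.inl rfl⟩
    · exfalso
      rcases hj with rfl | rfl
      · rcases le_or_gt (ε j) t with hjt | hjt
        · rw [elimRank_bot, elimRank_top_of_le hjt] at hr; omega
        · rw [elimRank_bot, elimRank_top_of_lt hjt] at hr; omega
      · exact lt_irrefl _ hr
  obtain ⟨k, rfl⟩ : ∃ k : Fin (c + 1), j = k.castSucc := ⟨⟨j, by omega⟩, rfl⟩
  have hpw : elimRank c ε t p < elimRank c ε t (bot k.succ) := by
    rw [elimRank_bot, Fin.val_succ]
    rcases hj with rfl | rfl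
    · rw [elimRank_bot, Fin.val_castSucc]; omega
    · rw [elimRank_top_of_le (by by_contra! hlt; exact hborn ⟨rfl, hlt⟩), Fin.val_castSucc]; omega
  rcases le_or_gt (√2 * ε k) t with hdiag | hdiag
  · -- The square is filled: `bot (k + 1)` dominates.
    refine ⟨bot k.succ, fun q hr hq => ⟨hpw, Or.inr ?_⟩⟩
    have hwq := h.near_bot_of_near ht (i := k.castSucc) (j := k.succ) rfl hdiag hpj (hcol q hr) hq.1
    refine ⟨uncut_of_bot hwq, triple_mem_vietorisRips ?_ hwq hq.1⟩
    rcases hj with rfl | rfl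
    · refine (h.near_bot_bot_succ ht rfl).mpr (le_trans ?_ hdiag)
      exact (h.increasing k (by omega)).le.trans (h.lt_sqrt_two_mul_sub_one (by omega)).le
    · exact (h.near_top_bot_succ ht rfl).mpr hdiag
  · -- Only the column `k` and the next one can be adjacent to `p`, and all that remains is a leaf.
    have hnext : ∀ q, elimRank c ε t p < elimRank c ε t q → Near ε t p q →
        ((ofLex q).1 : ℕ) = k ∨ ((ofLex q).1 : ℕ) = k + 1 := by
      intro q hr hq
      have h1 : (k : ℕ) ≤ (ofLex q).1 := hcol q hr
      by_contra hne
      refine h.not_near_of_add_two_le ht (p := p) (q := q) ?_ (by rw [hpj]; exact hdiag) hq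
      rw [hpj, Fin.val_castSucc]
      omega
    rcases hj with rfl | rfl
    · refine ⟨bot k.succ, fun q hr hq => ⟨hpw, Or.inl ?_⟩⟩
      have hq' := hnext q hr hq.1
      obtain ⟨i, rfl | rfl⟩ := eq_bot_or_eq_top q
      · change (i : ℕ) = k ∨ (i : ℕ) = k + 1 at hq'
        rw [elimRank_bot, elimRank_bot, Fin.val_castSucc] at hr
        exact bot_inj.mpr (Fin.ext (by rw [Fin.val_succ]; omega))
      · change (i : ℕ) = k ∨ (i : ℕ) = k + 1 at hq'
        exfalso
        rcases hq' with hi | hi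
        · rcases le_or_gt (ε i) t with hit | hit
          · rw [elimRank_bot, elimRank_top_of_le hit, Fin.val_castSucc] at hr; omega
          · rw [elimRank_bot, elimRank_top_of_lt hit] at hr; omega
        · exact h.not_near_bot_top_succ ht (i := k.castSucc) hi.symm hdiag hq.1
    · have hkt : ε k.castSucc ≤ t := by by_contra! hlt; exact hborn ⟨rfl, hlt⟩
      refine ⟨bot k.castSucc, fun q hr hq => ⟨?_, Or.inl ?_⟩⟩
      · rw [elimRank_top_of_le hkt, elimRank_bot]; omega
      have hq' := hnext q hr hq.1
      obtain ⟨i, rfl | rfl⟩ := eq_bot_or_eq_top q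
      · change (i : ℕ) = k ∨ (i : ℕ) = k + 1 at hq'
        rcases hq' with hi | hi
        · exact bot_inj.mpr (Fin.ext hi)
        · exact absurd ((h.near_top_bot_succ ht (i := k.castSucc) hi.symm).mp hq.1)
            (not_le.mpr hdiag)
      · change (i : ℕ) = k ∨ (i : ℕ) = k + 1 at hq'
        exfalso
        rcases le_or_gt (ε i) t with hit | hit
        · rw [elimRank_top_of_le hkt, elimRank_top_of_le hit, Fin.val_castSucc] at hr
          have hi : (i : ℕ) = k + 1 := by omega
          exact (hq.2 k (hi ▸ hit) hdiag).1 ⟨rfl, top_inj.mpr (Fin.ext hi)⟩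
        · rw [elimRank_top_of_le hkt, elimRank_top_of_lt hit] at hr; omega

/-- A cycle whose coefficients on the upper edges of the unfilled squares are `0` is a boundary. -/
theorem Admissible.mem_boundaries {t : ℝ≥0} {z : Chain K (Fin (c + 2) ×ₗ Fin 2) 1}
    (hz : z ∈ cycles K (vietorisRips (pointCloud c ε) t) 1)
    (hz0 : ∀ k : Fin (c + 1), ε (k + 1) ≤ t → t < √2 * ε k → z (upperEdge k) = 0) :
    z ∈ boundaries K (vietorisRips (pointCloud c ε) t) 1 := by
  refine mem_boundaries_of_elimination (Uncut c ε t) ?_ _ (elimRank_injective t)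
    h.exists_dominating hz ?_
  · exact fun p q hpq => ⟨hpq.1.symm, fun k hk hk' => (hpq.2 k hk hk').symm⟩
  · intro σ hσ
    have hmem := hz.1 (Finsupp.mem_support_iff.mpr hσ)
    have h01 : σ 0 < σ 1 := σ.strictMono (by decide)
    refine ⟨?_, fun k hk hk' => ⟨?_, ?_⟩⟩
    · exact (mem_vietorisRips_iff.mp hmem).2 (by simp) (by simp) h01.ne
    · rintro ⟨e0, e1⟩
      apply hσ
      rw [← hz0 k hk hk']
      congr 1
      ext i
      fin_cases i
      · exact e0
      · exact e1
    · rintro ⟨e1, e0⟩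
      exact (top_lt_top k.castSucc_lt_succ).asymm (e0 ▸ e1 ▸ h01)

end Spanning

/-! ### The barcode of the point cloud -/

section Bars

variable {c : ℕ} {ε : ℕ → ℝ}

/-- The half-open bar `[a, b)`. -/
def icoBar (a b : ℝ) (ha : 0 ≤ a) (hab : a < b) : Bar ℝ≥0 where
  carrier := {s | a ≤ (s : ℝ) ∧ (s : ℝ) < b}
  nonempty := ⟨⟨a, ha⟩, le_rfl, hab⟩
  ordConnected := ⟨fun _ hx _ hy _ hz =>
    ⟨hx.1.trans (NNReal.coe_le_coe.mpr hz.1), (NNReal.coe_le_coe.mpr hz.2).trans_lt hy.2⟩⟩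

theorem birth_icoBar (a b : ℝ) (ha : 0 ≤ a) (hab : a < b) :
    (icoBar a b ha hab).birth = ENNReal.ofReal a := by
  refine le_antisymm ?_ (le_iInf₂ fun s hs => ?_)
  · refine (iInf₂_le (⟨a, ha⟩ : ℝ≥0) ⟨le_rfl, hab⟩).trans_eq ?_
    exact (ENNReal.ofReal_eq_coe_nnreal ha).symm
  · rw [← ENNReal.ofReal_coe_nnreal]
    exact ENNReal.ofReal_le_ofReal hs.1

theorem death_icoBar (a b : ℝ) (ha : 0 ≤ a) (hab : a < b) :
    (icoBar a b ha hab).death = ENNReal.ofReal b := by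
  refine le_antisymm (iSup₂_le fun s hs => ?_) ?_
  · rw [← ENNReal.ofReal_coe_nnreal]
    exact ENNReal.ofReal_le_ofReal hs.2.le
  · refine le_of_forall_lt fun x hx => ?_
    lift x to ℝ≥0 using hx.ne_top
    rw [← ENNReal.ofReal_coe_nnreal, ENNReal.ofReal_lt_ofReal_iff (ha.trans_lt hab)] at hx
    obtain ⟨y, hy, hyb⟩ := exists_between (max_lt hx hab)
    have hy0 : 0 ≤ y := ha.trans ((le_max_right _ _).trans hy.le)
    refine lt_of_lt_of_le ?_
      (le_iSup₂ (f := fun (s : ℝ≥0) (_ : s ∈ (icoBar a b ha hab).carrier) => (s : ℝ≥0∞))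
        ⟨y, hy0⟩ ⟨(le_max_right _ _).trans hy.le, hyb⟩)
    exact ENNReal.coe_lt_coe.mpr (NNReal.coe_lt_coe.mp ((le_max_left _ _).trans_lt hy))

theorem interlaced_icoBar {a b a' b' : ℝ} (ha : 0 ≤ a) (hab : a < b) (ha' : 0 ≤ a')
    (hab' : a' < b') (h1 : a < a') (h2 : a' ≤ b) (h3 : b < b') :
    Interlaced (icoBar a b ha hab) (icoBar a' b' ha' hab') := by
  rw [Interlaced, birth_icoBar, birth_icoBar, death_icoBar, death_icoBar,
    ENNReal.ofReal_lt_ofReal_iff (by linarith), ENNReal.ofReal_lt_ofReal_iff (by linarith)]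
  exact ⟨h1, ENNReal.ofReal_le_ofReal h2, h3⟩

theorem not_interacting_icoBar {a b a' b' : ℝ} (ha : 0 ≤ a) (hab : a < b) (ha' : 0 ≤ a')
    (hab' : a' < b') (h : b < a') :
    ¬ Interacting (icoBar a b ha hab) (icoBar a' b' ha' hab') := by
  rw [Interacting, Interlaced, Interlaced, NonSeparated, NonSeparated, birth_icoBar, birth_icoBar,
    death_icoBar, death_icoBar]
  rintro ((⟨-, h1, -⟩ | ⟨-, h1⟩) | (⟨h1, -⟩ | ⟨h1, -⟩))
  · rw [ENNReal.ofReal_le_ofReal_iff (by linarith)] at h1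
    linarith
  · obtain ⟨s, hs, hs'⟩ := exists_between h
    have hs0 : 0 ≤ s := by linarith
    lift s to ℝ≥0 using hs0
    refine h1 ⟨s, ?_, ?_⟩ <;>
      rw [← ENNReal.ofReal_coe_nnreal, ENNReal.ofReal_lt_ofReal_iff (by linarith)] <;>
      assumption
  · exact (ENNReal.ofReal_le_ofReal (by linarith)).not_gt h1
  · exact (ENNReal.ofReal_le_ofReal (by linarith)).not_gt h1

/-- The bar `[ε (k + 1), √2 * ε k)` of the square between the columns `k` and `k + 1`. -/
def Admissible.bar (h : Admissible c ε) (k : Fin (c + 1)) : Bar ℝ≥0 :=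
  icoBar (ε (k + 1)) (√2 * ε k) (h.pos (by omega)).le (h.lt_sqrt_two_mul_sub_one (by omega))

theorem Admissible.interlaced_bar (h : Admissible c ε) {k l : Fin (c + 1)}
    (hkl : (k : ℕ) + 1 = l) : Interlaced (h.bar k) (h.bar l) := by
  refine interlaced_icoBar _ _ _ _ ?_ ?_ ?_ <;> rw [← hkl]
  · exact h.increasing _ (by omega)
  · exact (h.lt_sqrt_two_mul_sub_two (by omega)).le
  · exact mul_lt_mul_of_pos_left (h.increasing _ (by omega)) (by positivity)

theorem Admissible.not_interacting_bar (h : Admissible c ε) {k l : Fin (c + 1)}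
    (hkl : (k : ℕ) + 1 < l) : ¬ Interacting (h.bar k) (h.bar l) := by
  refine not_interacting_icoBar _ _ _ _ ?_
  exact (h.sqrt_two_mul_sub_three_lt (by omega)).trans_le (h.le_of_le (by omega) (by omega))

theorem Admissible.numInteracting_bar (h : Admissible c ε) : numInteracting h.bar = c := by
  have hset : {p : Fin (c + 1) × Fin (c + 1) | p.1 < p.2 ∧ Interacting (h.bar p.1) (h.bar p.2)} =
      Set.range fun i : Fin c => (i.castSucc, i.succ) := by
    ext ⟨k, l⟩
    constructor
    · rintro ⟨hkl, hI⟩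
      have hkl' : (k : ℕ) < l := hkl
      have : (l : ℕ) = k + 1 := by
        by_contra hne
        exact h.not_interacting_bar (k := k) (l := l) (by omega) hI
      exact ⟨⟨k, by omega⟩, Prod.ext rfl (Fin.ext this.symm)⟩
    · rintro ⟨i, hi⟩
      obtain ⟨rfl, rfl⟩ := Prod.mk.inj hi
      exact ⟨i.castSucc_lt_succ, Or.inl (Or.inl (h.interlaced_bar rfl))⟩
  rw [numInteracting, hset, ← Set.image_univ, Set.ncard_image_of_injective, Set.ncard_univ,
    Nat.card_fin]
  exact fun i j hij => Fin.castSucc_injective _ (Prod.mk.inj hij).1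

theorem Admissible.isBarcode_bar (K : Type u) [Field K] (h : Admissible c ε) :
    IsBarcode (persistentHomology K 1 (vietorisRips (pointCloud c ε))) h.bar := by
  classical
  refine isBarcode_of_basis _ _ (squareChain K) (fun k s hs => h.squareChain_mem_cycles hs.1) ?_
    ?_ ?_
  · intro k s t hst hs ht
    refine h.squareChain_mem_boundaries ?_
    by_contra! hlt
    exact ht ⟨hs.1.trans (NNReal.coe_le_coe.mpr hst), hlt⟩
  · intro s y hy
    refine ⟨fun k => if s ∈ (h.bar k).carrier then y (upperEdge k) else 0,
      fun k hk => if_neg hk, ?_⟩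
    refine h.mem_boundaries (Submodule.sub_mem _ hy (Submodule.sum_mem _ fun k _ => ?_)) ?_
    · beta_reduce
      split_ifs with hk
      · exact Submodule.smul_mem _ _ (h.squareChain_mem_cycles hk.1)
      · rw [zero_smul]
        exact Submodule.zero_mem _
    · intro k hk hk'
      rw [Finsupp.sub_apply, sum_smul_squareChain_apply, if_pos ⟨hk, hk'⟩, sub_self]
  · intro s a ha hmem k
    by_cases hs : s ∈ (h.bar k).carrier
    · rw [← sum_smul_squareChain_apply a k]
      exact h.boundaries_apply_upperEdge hs.2 hmem
    · exact ha k hs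

end Bars

end QuiverCodim
end

open QuiverCodim in
theorem theorem8p2 (K : Type*) [Field K] (c : ℕ) :
    (∃ ε : ℕ → ℝ, Admissible c ε) ∧
    ∀ ε : ℕ → ℝ, Admissible c ε →
      Function.Injective (pointCloud c ε) ∧
      BarcodeFinite (persistentHomology K 1 (vietorisRips (pointCloud c ε))) ∧
      qcodim (persistentHomology K 1 (vietorisRips (pointCloud c ε))) = c ∧
      ∃ I : Fin (c + 1) → Bar NNReal,
        IsBarcode (persistentHomology K 1 (vietorisRips (pointCloud c ε))) I ∧
        (∀ k, (I k).carrier = {s : NNReal | ε (k + 1) ≤ (s : ℝ) ∧ (s : ℝ) < √2 * ε k}) ∧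
        (∀ k l : Fin (c + 1), (k : ℕ) + 1 = l → Interlaced (I k) (I l)) ∧
        (∀ k l : Fin (c + 1), (k : ℕ) + 1 < l → ¬ Interacting (I k) (I l)) := by
  refine ⟨⟨_, admissible_pow c⟩, fun ε h => ?_⟩
  have hB := h.isBarcode_bar K
  refine ⟨h.injective_pointCloud, ⟨_, _, hB⟩, ?_, h.bar, hB, fun _ => rfl,
    fun _ _ => h.interlaced_bar, fun _ _ => h.not_interacting_bar⟩
  rw [qcodim_eq_numInteracting hB, h.numInteracting_bar]
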